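/- Consider weighted graphs on the vertex set $\{1,\dots,n\}$, given by a weight for each of the $\binom n2$ pairs of distinct vertices (weight $0$ for non-edges); the weight of a cut is the sum of the weights of the pairs it separates. Fix real numbers $\beta<\alpha$, constants $a,b,C>0$ and $q\in\mathbb R$, and a function $c_{out}(n)=o(n^\alpha)$. Then there is $n_0$, depending only on these data, such that the following holds for all $n\ge n_0$, all $k$, all $\delta\in(0,1)$ and all $m$. *Graph.* The vertices are partitioned into $k$ clusters, each of size at least $an$. The weights inside the clusters are arbitrary numbers in $[0,1]$ such that every cut of the subgraph induced on a cluster (i.e. separating a nonempty proper subset of the cluster from the rest of the cluster) has weight at least $c_{in}\ge bn^\alpha$. For any two distinct clusters $i,j$ let $c_{ij}\le c_{out}(n)$ be a natural number not exceeding the number of pairs between the two clusters (e.g. the same number for all $i,j$); independently for each two clusters, $c_{ij}$ of the pairs between them are chosen uniformly at random without replacement and given weight $1$, and all other pairs between clusters have weight $0$. Call the resulting random graph $G$. *Sampling.* Fix any adaptive sampling scheme, i.e. any rule that assigns to the set of pairs sampled so far and to the graph seen so far (the sampled pairs with their weights) a probability distribution on the unseen pairs. At each of $m$ steps, with probability $1/2$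 an unseen pair is sampled uniformly at random, and with probability $1/2$ an unseen pair is sampled according to the scheme (if no pair is left, nothing is done). Let $\tilde G$ be the graph in which the sampled pairs have their weights in $G$, without rescaling, and all other pairs have weight $0$. *Claim.* Let $\tilde c_{in}$ be the minimal weight in $\tilde G$ of a cut inside a cluster (the minimum over all clusters and all nonempty proper subsets of the cluster, in the induced subgraph), and let $\tilde c_{out}$ be the maximal weight in $\tilde G$ of a cut between clusters (one that separates some, but not all, clusters from the others and splits no cluster). If $$m\ \ge\ C\,n^{2-\beta}\,(\ln n)^{q}\,k\,\ln\tfrac1\delta ,$$ then, over the choice of the random edges and of the samples, $$P\left(\tilde c_{in}<\tilde c_{out}\right)<\delta .$$ -/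

import Mathlib

open Finset Filter Asymptotics
open scoped ENNReal

noncomputable section

namespace AdaptiveClustering

open scoped Classical in
/-- The edges of the complete graph on `V`: all unordered pairs of distinct vertices.
Every graph is a full weighted graph, given by a weight `w e` for each of these pairs. -/
def pairs (V : Type*) [Fintype V] : Finset (Sym2 V) :=
  univ.filter fun e => ¬ e.IsDiag

/-- For `S ⊆ U`, the weight of the cut defined by `S` in the subgraph induced on `U`: the total
weight of the edges with one endpoint in `S` and the other in `U \ S`. -/
def cutWeight {V : Type*} [DecidableEq V] (w : Sym2 V → ℝ) (U S : Finset V) : ℝ :=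
  ∑ u ∈ S, ∑ v ∈ U \ S, w s(u, v)

/-- The `i`-th cluster of the partition described by the labelling `cl`. -/
def cluster {V : Type*} [Fintype V] {k : ℕ} (cl : V → Fin k) (i : Fin k) : Finset V :=
  univ.filter fun v => cl v = i

/-- The minimal weight of a cut inside a cluster: the minimum over all clusters `C` and all
nonempty proper subsets `S` of `C` of the cut of `S` in the subgraph induced on `C`. -/
def minInnerCut {V : Type*} [Fintype V] [DecidableEq V] {k : ℕ}
    (w : Sym2 V → ℝ) (cl : V → Fin k) : EReal :=
  ⨅ (i : Fin k) (S : Finset V) (_ : S.Nonempty) (_ : S ⊂ cluster cl i),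
    ((cutWeight w (cluster cl i) S : ℝ) : EReal)

/-- The maximal weight of a cut between clusters: the maximum over all cuts of the whole graph
that separate some, but not all, of the clusters from the others and split no cluster. -/
def maxOuterCut {V : Type*} [Fintype V] [DecidableEq V] {k : ℕ}
    (w : Sym2 V → ℝ) (cl : V → Fin k) : EReal :=
  ⨆ (I : Finset (Fin k)) (_ : I.Nonempty) (_ : I ≠ univ),
    ((cutWeight w univ (univ.filter fun v => cl v ∈ I) : ℝ) : EReal)

open scoped Classical in
/-- The sets `E` of inter-cluster edges that have exactly `d s(i, j)` elements between clusters
`i` and `j`, for all `i ≠ j`. A uniformly random such set is the same as an independent choice,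
for each pair of clusters, of `d s(i, j)` edges uniformly without replacement. -/
def noiseSets {V : Type*} [Fintype V] {k : ℕ} (cl : V → Fin k) (d : Sym2 (Fin k) → ℕ) :
    Finset (Finset (Sym2 V)) :=
  univ.filter fun E => (∀ e ∈ E, ¬ (e.map cl).IsDiag) ∧
    ∀ i j : Fin k, i ≠ j → (E.filter fun e => e.map cl = s(i, j)).card = d s(i, j)

open scoped Classical in
/-- The weights of the graph with weights `win` inside the clusters, weight `1` on the edges
of `E` between clusters, and weight `0` on the other edges between clusters. -/
def graphWeight {V : Type*} {k : ℕ} (cl : V → Fin k) (win : Sym2 V → ℝ)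
    (E : Finset (Sym2 V)) (e : Sym2 V) : ℝ :=
  if (e.map cl).IsDiag then win e else if e ∈ E then 1 else 0

open scoped Classical in
/-- The graph seen after sampling the edges in `seen`: sampled edges keep their weight
(no rescaling), all other edges have weight `0`. -/
def observed {V : Type*} (w : Sym2 V → ℝ) (seen : Finset (Sym2 V)) (e : Sym2 V) : ℝ :=
  if e ∈ seen then w e else 0

open scoped Classical in
/-- An adaptive sampling algorithm: given the set of sampled edges and the graph seen so far,
a probability distribution on the unseen edges (as long as there are any). -/
structure AdaptiveScheme (V : Type*) [Fintype V] where
  pick : Finset (Sym2 V) → (Sym2 V → ℝ) → PMF (Sym2 V)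
  pick_unseen : ∀ (seen : Finset (Sym2 V)) (obs : Sym2 V → ℝ), (pairs V \ seen).Nonempty →
    ∀ e ∈ (pick seen obs).support, e ∈ pairs V \ seen

open scoped Classical in
/-- One step of biased sampling: toss a fair coin; on heads sample a uniformly random unseen
edge, on tails sample an unseen edge with the adaptive scheme. When every edge has been seen,
nothing happens. -/
def stepLaw {V : Type*} [Fintype V] (A : AdaptiveScheme V) (w : Sym2 V → ℝ)
    (seen : Finset (Sym2 V)) : PMF (Finset (Sym2 V)) :=
  if h : (pairs V \ seen).Nonempty then
    (PMF.uniformOfFintype Bool).bind fun heads =>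
      (if heads then PMF.uniformOfFinset (pairs V \ seen) h
        else A.pick seen (observed w seen)).map fun e => insert e seen
  else PMF.pure seen

/-- The law of the set of edges sampled in the first `m` steps. -/
def sampleLaw {V : Type*} [Fintype V] (A : AdaptiveScheme V) (w : Sym2 V → ℝ) :
    ℕ → PMF (Finset (Sym2 V))
  | 0 => PMF.pure ∅
  | m + 1 => (sampleLaw A w m).bind (stepLaw A w)

/-- The law of the sampled graph: first the edges between clusters are drawn at random, then `m`
edges of the resulting graph are sampled. -/
def sampledGraphLaw {V : Type*} [Fintype V] {k : ℕ} (cl : V → Fin k) (win : Sym2 V → ℝ)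
    (d : Sym2 (Fin k) → ℕ) (hd : (noiseSets cl d).Nonempty) (A : AdaptiveScheme V) (m : ℕ) :
    PMF (Sym2 V → ℝ) :=
  (PMF.uniformOfFinset (noiseSets cl d) hd).bind fun E =>
    (sampleLaw A (graphWeight cl win E) m).map (observed (graphWeight cl win E))

end AdaptiveClustering

end

/-! Write N for the number of pairs, u = n^(α-2) and D for a bound on the noise edges between two
clusters, so that D ≤ η n^α with η as small as desired for large n. A cut between clusters weighs at
most the number of sampled noise edges, so failure forces some inner cut to have sampled weight
below that number.

Inner cuts. While a cut of weight c has been sampled to less than half, each uniform step hits it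
with expected weight at least c/(2N), and adaptive steps never hurt. Hence exp(-X), with X the
sampled weight, shrinks by exp(-c/(8N)) per step (`ev_sampleLaw_lt_le`). The union bound over
exponentially many cuts is affordable because light cuts are rare: if all cuts of a graph on r
vertices weigh at least c, then Σ exp(-t·cut) ≤ (1 + exp(-ct/2))^r - 1 (`sum_exp_neg_multiCut_le`),
by induction on edge contractions and a differential inequality in t.

Noise. However adaptive the scheme, given what was seen, the unseen pairs between two fixed clusters
are exchangeable. As long as at most half of a block's B pairs can have been seen, the next pair is
noise with conditional probability at most 2D/B. This gives an exponential moment of the number of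
sampled noise edges (`noiseGen_le`) and a lower bound for the probability of sampling none
(`noiseGen_zero_ge`).

Conclusion. The bound on m gives δ ≥ exp(-m u / n^ε) with α - β = 2ε. If m u is at least a large
multiple of ln n, a threshold between inner cuts and noise gives failure probability at most 3
exp(-b m u / 64) (`failure_le_of_many_samples`). If m u is smaller, δ is within n^(-ε/2) of 1, and
it suffices that no noise edge at all is sampled with larger probability than that
(`failure_le_of_few_samples`). -/

namespace AdaptiveClustering

/-! ### Counting light cuts by contraction -/

section CutCounting

/-- The weight of the cut `S` in the multigraph with edge set `E`, edge weights `w` and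
endpoint maps `p`, `q`. -/
def multiCut {E ι : Type*} [Fintype E] [DecidableEq ι] (w : E → ℝ) (p q : E → ι)
    (S : Finset ι) : ℝ :=
  ∑ e, if (p e ∈ S ↔ q e ∈ S) then 0 else w e

/-- The nonempty proper subsets of a finite type. -/
def properSets (ι : Type*) [Fintype ι] [DecidableEq ι] : Finset (Finset ι) :=
  univ.filter fun S => S.Nonempty ∧ S ≠ univ

theorem mem_properSets {ι : Type*} [Fintype ι] [DecidableEq ι] {S : Finset ι} :
    S ∈ properSets ι ↔ S.Nonempty ∧ S ≠ univ := by
  simp [properSets]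

theorem card_properSets_le (ι : Type*) [Fintype ι] [DecidableEq ι] :
    ((properSets ι).card : ℝ) ≤ 2 ^ Fintype.card ι - 1 := by
  have h : (properSets ι) ⊆ univ.erase (univ : Finset ι) := by
    intro S hS
    simpa using (mem_properSets.1 hS).2
  have h1 := card_le_card h
  rw [card_erase_of_mem (mem_univ _), card_univ, Fintype.card_finset] at h1
  have h2 : 1 ≤ 2 ^ Fintype.card ι := Nat.one_le_two_pow
  have : ((properSets ι).card : ℝ) ≤ ((2 ^ Fintype.card ι - 1 : ℕ) : ℝ) := by exact_mod_cast h1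
  rw [Nat.cast_sub h2] at this
  simpa using this

/-- The contraction map identifying `j` with `i`. -/
def contract {ι : Type*} [DecidableEq ι] {i j : ι} (hij : i ≠ j) (x : ι) : {x : ι // x ≠ j} :=
  if h : x = j then ⟨i, hij⟩ else ⟨x, h⟩

theorem contract_coe {ι : Type*} [DecidableEq ι] {i j : ι} (hij : i ≠ j) (x : {x : ι // x ≠ j}) :
    contract hij x.1 = x := by
  simp [contract, x.2]

theorem multiCut_contract {E ι κ : Type*} [Fintype E] [DecidableEq ι] [DecidableEq κ]
    (w : E → ℝ) (p q : E → ι) (f : ι → κ) (S : Finset ι) (S' : Finset κ)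
    (h : ∀ x, f x ∈ S' ↔ x ∈ S) :
    multiCut w (f ∘ p) (f ∘ q) S' = multiCut w p q S := by
  simp [multiCut, h]

/-- Cuts that do not separate `i` and `j` are exactly the cuts of the graph with `j` merged into
`i`. The edge type stays the same: edges between `i` and `j` become loops, which no cut sees. This
lets the induction on the number of vertices keep `E` and `w` fixed. -/
theorem sum_contract {E ι : Type*} [Fintype E] [Fintype ι] [DecidableEq ι]
    (w : E → ℝ) (p q : E → ι) (g : ℝ → ℝ) {i j : ι} (hij : i ≠ j) :
    ∑ S ∈ (properSets ι).filter (fun S => (i ∈ S ↔ j ∈ S)), g (multiCut w p q S) =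
      ∑ S ∈ properSets {x : ι // x ≠ j},
        g (multiCut w (contract hij ∘ p) (contract hij ∘ q) S) := by
  have key : ∀ S : Finset ι, (i ∈ S ↔ j ∈ S) → ∀ x,
      contract hij x ∈ S.subtype (fun x => x ≠ j) ↔ x ∈ S := by
    intro S hS x
    by_cases h : x = j
    · subst h; simp [contract, hS]
    · simp [contract, h]
  refine sum_bij' (fun S _ => S.subtype (fun x => x ≠ j))
    (fun S _ => univ.filter fun x => contract hij x ∈ S) ?_ ?_ ?_ ?_ ?_
  · intro S hS
    rw [mem_filter, mem_properSets] at hS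
    obtain ⟨⟨⟨x, hx⟩, hne⟩, hs⟩ := hS
    rw [mem_properSets]
    refine ⟨⟨contract hij x, (key S hs x).2 hx⟩, fun h => hne ?_⟩
    ext y
    rw [← key S hs y, h]
    simp
  · intro S hS
    rw [mem_properSets] at hS
    obtain ⟨⟨x, hx⟩, hne⟩ := hS
    rw [mem_filter, mem_properSets]
    refine ⟨⟨⟨x.1, by simpa [contract_coe] using hx⟩, fun h => hne ?_⟩, ?_⟩
    · ext y
      have := congrArg (fun T => y.1 ∈ T) h
      simpa [contract_coe] using this
    · simp [contract, hij]
  · intro S hS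
    rw [mem_filter] at hS
    ext x
    rw [mem_filter, key S hS.2 x]
    simp
  · intro S hS
    ext x
    simp only [mem_subtype, mem_filter, mem_univ, true_and]
    rw [contract_coe]
  · intro S hS
    rw [mem_filter] at hS
    rw [multiCut_contract w p q _ S _ (key S hS.2)]

/-- The total weight of the edges that are not loops is at least `c / 2` per vertex when all
cuts have weight at least `c`. -/
theorem card_mul_le_sum_nonloop {E ι : Type*} [Fintype E] [Fintype ι] [DecidableEq ι]
    (w : E → ℝ) (p q : E → ι) (c : ℝ) (hι : 2 ≤ Fintype.card ι)
    (hmin : ∀ S ∈ properSets ι, c ≤ multiCut w p q S) :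
    Fintype.card ι * c / 2 ≤ ∑ e, if p e = q e then 0 else w e := by
  -- Sum the cuts around single vertices; every non-loop is counted exactly twice.
  have h1 : ∑ _x : ι, c ≤ ∑ x : ι, multiCut w p q {x} := by
    refine sum_le_sum fun x _ => hmin _ (mem_properSets.2 ⟨singleton_nonempty x, fun h => ?_⟩)
    have := congrArg card h
    rw [card_singleton, card_univ] at this
    omega
  have h2 : ∑ x : ι, multiCut w p q {x} = 2 * ∑ e, if p e = q e then 0 else w e := by
    unfold multiCut
    rw [sum_comm, mul_sum]
    refine sum_congr rfl fun e _ => ?_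
    by_cases h : p e = q e
    · simp [h]
    · have : ∀ x : ι, (if (p e ∈ ({x} : Finset ι) ↔ q e ∈ ({x} : Finset ι)) then 0 else w e) =
          (if p e = x then w e else 0) + (if q e = x then w e else 0) := by
        intro x
        by_cases h1 : p e = x
        · have : q e ≠ x := fun h2 => h (h1.trans h2.symm)
          simp [h1, this]
        · by_cases h2 : q e = x <;> simp [h1, h2]
      simp_rw [this, sum_add_distrib]
      simp [h]
      ring
  rw [h2] at h1
  simp at h1
  linarith

/-- Comparison for the linear differential inequality `D' ≥ - W D`. -/
theorem nonneg_of_deriv_ge {D D' : ℝ → ℝ} {W : ℝ} (hD : ∀ t, HasDerivAt D (D' t) t)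
    (h0 : 0 ≤ D 0) (h : ∀ t, 0 ≤ t → -(W * D t) ≤ D' t) {t : ℝ} (ht : 0 ≤ t) : 0 ≤ D t := by
  -- Integrating factor: `exp (W t) D t` is nondecreasing on `t ≥ 0`.
  have hder : ∀ t, HasDerivAt (fun t => Real.exp (W * t) * D t)
      (Real.exp (W * t) * W * D t + Real.exp (W * t) * D' t) t := by
    intro t
    have h1 : HasDerivAt (fun t => Real.exp (W * t)) (Real.exp (W * t) * W) t := by
      simpa using ((hasDerivAt_id t).const_mul W).exp
    exact h1.mul (hD t)
  have hmono : MonotoneOn (fun t => Real.exp (W * t) * D t) (Set.Ici 0) := by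
    refine monotoneOn_of_deriv_nonneg (convex_Ici 0)
      (fun t _ => (hder t).continuousAt.continuousWithinAt)
      (fun t _ => (hder t).differentiableAt.differentiableWithinAt) fun t ht => ?_
    rw [interior_Ici] at ht
    rw [(hder t).deriv]
    have := h t (le_of_lt ht)
    have h2 := mul_le_mul_of_nonneg_left this (Real.exp_pos (W * t)).le
    linarith
  have := hmono (Set.self_mem_Ici) (show t ∈ Set.Ici (0 : ℝ) from ht) ht
  simp only [mul_zero, Real.exp_zero, one_mul] at this
  have h3 : 0 ≤ Real.exp (W * t) * D t := h0.trans this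
  exact nonneg_of_mul_nonneg_right h3 (Real.exp_pos _)

/-- A graph on `r + 1` vertices all of whose cuts have weight at least `c` has few light cuts. -/
theorem sum_exp_neg_multiCut_le {E : Type*} [Fintype E] (w : E → ℝ) (hw : ∀ e, 0 ≤ w e)
    (c : ℝ) (r : ℕ) :
    ∀ {ι : Type} [Fintype ι] [DecidableEq ι], Fintype.card ι = r + 1 → ∀ (p q : E → ι),
      (∀ S ∈ properSets ι, c ≤ multiCut w p q S) → ∀ t : ℝ, 0 ≤ t →
      ∑ S ∈ properSets ι, Real.exp (-(t * multiCut w p q S)) ≤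
        (1 + Real.exp (-(c / 2 * t))) ^ (r + 1) - 1 := by
  induction r with
  | zero =>
    intro ι _ _ hι p q _ t _
    have : properSets ι = ∅ := by
      refine eq_empty_of_forall_notMem fun S hS => ?_
      obtain ⟨hS1, hS2⟩ := mem_properSets.1 hS
      have h1 := hS1.card_pos
      have h2 := card_lt_card (ssubset_univ_iff.2 hS2)
      rw [card_univ] at h2
      omega
    rw [this]
    simp [Real.exp_nonneg]
  | succ r ih =>
    intro ι _ _ hι p q hmin t ht
    set x : ℝ → ℝ := fun t => Real.exp (-(c / 2 * t)) with hx
    set F : ℝ → ℝ := fun t => ∑ S ∈ properSets ι, Real.exp (-(t * multiCut w p q S)) with hF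
    set W := ∑ e, (if p e = q e then 0 else w e) with hWdef
    have hW : ((r : ℝ) + 2) * c / 2 ≤ W := by
      have := card_mul_le_sum_nonloop w p q c (by omega) hmin
      rw [hι] at this
      push_cast at this
      linarith
    have hxd : ∀ t, HasDerivAt x (-(c / 2 * x t)) t := by
      intro t
      convert (((hasDerivAt_id' t).const_mul (c / 2)).fun_neg).exp using 1
      simp only [hx]
      ring
    have hFd : ∀ t, HasDerivAt F
        (∑ S ∈ properSets ι, -(multiCut w p q S * Real.exp (-(t * multiCut w p q S)))) t := by
      intro t
      refine HasDerivAt.fun_sum fun S _ => ?_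
      have h : HasDerivAt (fun t => Real.exp (-(t * multiCut w p q S)))
          (-(multiCut w p q S * Real.exp (-(t * multiCut w p q S)))) t := by
        convert (((hasDerivAt_id' t).mul_const (multiCut w p q S)).fun_neg).exp using 1
        ring
      exact h
    -- The right side is `-F'`. Grouped by edges, it is the sum over `e` of `w e` times the part of
    -- `F` from cuts separating `e`. The remaining part of `F` is the same sum for the graph with
    -- `e` contracted, which the induction hypothesis bounds.
    have hrec : ∀ t, 0 ≤ t → W * F t - W * ((1 + x t) ^ (r + 1) - 1) ≤
        ∑ S ∈ properSets ι, multiCut w p q S * Real.exp (-(t * multiCut w p q S)) := by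
      intro t ht
      have h1 : ∀ e, (if p e = q e then 0 else w e) * F t -
            (if p e = q e then 0 else w e) * ((1 + x t) ^ (r + 1) - 1) ≤
          ∑ S ∈ properSets ι, (if (p e ∈ S ↔ q e ∈ S) then 0 else w e) *
            Real.exp (-(t * multiCut w p q S)) := by
        intro e
        by_cases h : p e = q e
        · simp [h]
        · simp only [h, if_false]
          have h2 := sum_contract w p q (fun y => Real.exp (-(t * y))) h
          have h3 := ih (ι := {x : ι // x ≠ q e})
            (by rw [Fintype.card_subtype_compl, Fintype.card_subtype_eq, hι]; rfl)
            (contract h ∘ p) (contract h ∘ q) (by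
              intro S' hS'
              obtain ⟨⟨y, hy⟩, hne⟩ := mem_properSets.1 hS'
              rw [multiCut_contract w p q (contract h) (univ.filter fun x => contract h x ∈ S') S'
                (by simp)]
              refine hmin _ (mem_properSets.2 ⟨⟨y.1, by simpa [contract_coe] using hy⟩,
                fun hu => hne ?_⟩)
              ext z
              have := congrArg (fun T => z.1 ∈ T) hu
              simpa [contract_coe] using this) t ht
          rw [← h2] at h3
          have h4 : F t = ∑ S ∈ (properSets ι).filter (fun S => (p e ∈ S ↔ q e ∈ S)),
                Real.exp (-(t * multiCut w p q S)) +
              ∑ S ∈ (properSets ι).filter (fun S => ¬(p e ∈ S ↔ q e ∈ S)),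
                Real.exp (-(t * multiCut w p q S)) :=
            (sum_filter_add_sum_filter_not _ _ _).symm
          have h5 : ∑ S ∈ properSets ι, (if (p e ∈ S ↔ q e ∈ S) then 0 else w e) *
              Real.exp (-(t * multiCut w p q S)) =
              w e * ∑ S ∈ (properSets ι).filter (fun S => ¬(p e ∈ S ↔ q e ∈ S)),
                Real.exp (-(t * multiCut w p q S)) := by
            rw [mul_sum, sum_filter]
            refine sum_congr rfl fun S _ => ?_
            by_cases hS : (p e ∈ S ↔ q e ∈ S) <;> simp [hS]
          rw [h5, ← mul_sub]
          refine mul_le_mul_of_nonneg_left ?_ (hw e)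
          simp only [hx]
          linarith
      have h2 := sum_le_sum fun e (_ : e ∈ univ) => h1 e
      rw [sum_sub_distrib, ← sum_mul, ← sum_mul] at h2
      refine h2.trans (le_of_eq ?_)
      rw [sum_comm]
      refine sum_congr rfl fun S _ => ?_
      rw [← sum_mul]
      rfl
    -- Compare `F` with `(1 + x)^(r+2) - 1`, where `x = exp (-(c/2) t)`. At `t = 0` the comparison
    -- is the number of proper subsets against `2^(r+2) - 1`.
    have := nonneg_of_deriv_ge (D := fun t => (1 + x t) ^ (r + 2) - 1 - F t) (W := W)
      (fun t => ((((hxd t).const_add 1).pow (r + 2)).sub_const 1).sub (hFd t)) ?_ ?_ ht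
    · simpa [hF, hx] using this
    · have h1 := card_properSets_le ι
      rw [hι] at h1
      have h2 : F 0 = (properSets ι).card := by simp [hF]
      have h3 : x 0 = 1 := by simp [hx]
      simp only [h2, h3]
      norm_num
      have : ((r : ℕ) + 1 + 1) = r + 2 := rfl
      rw [this] at h1
      linarith
    · intro t ht
      have h1 := hrec t ht
      have hx0 : 0 ≤ x t := Real.exp_nonneg _
      -- The derivative of `(1 + x)^(r+2)` is `-(r+2)(c/2) x (1 + x)^(r+1)`, and `x (1 + x)^(r+1)`
      -- is the difference of the powers `r+2` and `r+1`. So the bound on `W` is what the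
      -- differential inequality needs.
      have h2 : ((r : ℝ) + 2) * c / 2 * (x t * (1 + x t) ^ (r + 1)) ≤
          W * (x t * (1 + x t) ^ (r + 1)) :=
        mul_le_mul_of_nonneg_right hW (by positivity)
      rw [sum_neg_distrib]
      push_cast
      rw [pow_succ (1 + x t) (r + 1)]
      nlinarith [h1, h2]

end CutCounting

/-! ### Expectations over finite probability spaces -/

section Expectation

variable {α : Type*} [Fintype α]

/-- The expectation of a real function under a probability mass function on a finite type. -/
noncomputable def ev (p : PMF α) (f : α → ℝ) : ℝ := ∑ a, (p a).toReal * f a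

theorem sum_toReal (p : PMF α) : ∑ a, (p a).toReal = 1 := by
  rw [← ENNReal.toReal_sum fun a _ => p.apply_ne_top a, ← tsum_fintype (L := .unconditional α),
    p.tsum_coe]
  rfl

theorem ev_const (p : PMF α) (c : ℝ) : ev p (fun _ => c) = c := by
  rw [ev, ← sum_mul, sum_toReal, one_mul]

theorem ev_add (p : PMF α) (f g : α → ℝ) : ev p (fun a => f a + g a) = ev p f + ev p g := by
  simp [ev, mul_add, sum_add_distrib]

theorem ev_const_mul (p : PMF α) (c : ℝ) (f : α → ℝ) :
    ev p (fun a => c * f a) = c * ev p f := by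
  simp only [ev, mul_sum]
  exact sum_congr rfl fun a _ => by ring

theorem ev_sum {ι : Type*} (p : PMF α) (s : Finset ι) (f : ι → α → ℝ) :
    ev p (fun a => ∑ i ∈ s, f i a) = ∑ i ∈ s, ev p (f i) := by
  simp only [ev, mul_sum]
  exact sum_comm

theorem ev_mono_of_support (p : PMF α) {f g : α → ℝ} (h : ∀ a ∈ p.support, f a ≤ g a) :
    ev p f ≤ ev p g := by
  refine sum_le_sum fun a _ => ?_
  by_cases ha : p a = 0
  · simp [ha]
  · exact mul_le_mul_of_nonneg_left (h a ((PMF.mem_support_iff p a).2 ha)) ENNReal.toReal_nonneg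

theorem ev_mono (p : PMF α) {f g : α → ℝ} (h : ∀ a, f a ≤ g a) : ev p f ≤ ev p g :=
  ev_mono_of_support p fun a _ => h a

theorem ev_congr_of_support (p : PMF α) {f g : α → ℝ} (h : ∀ a ∈ p.support, f a = g a) :
    ev p f = ev p g :=
  le_antisymm (ev_mono_of_support p fun a ha => (h a ha).le)
    (ev_mono_of_support p fun a ha => (h a ha).ge)

theorem ev_nonneg (p : PMF α) {f : α → ℝ} (h : ∀ a, 0 ≤ f a) : 0 ≤ ev p f :=
  sum_nonneg fun a _ => mul_nonneg ENNReal.toReal_nonneg (h a)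

theorem toReal_bind {β : Type*} (p : PMF α) (g : α → PMF β) (b : β) :
    ((p.bind g) b).toReal = ∑ a, (p a).toReal * (g a b).toReal := by
  rw [PMF.bind_apply, tsum_fintype, ENNReal.toReal_sum fun a _ =>
    ENNReal.mul_ne_top (p.apply_ne_top a) ((g a).apply_ne_top b)]
  simp [ENNReal.toReal_mul]

theorem ev_bind {β : Type*} [Fintype β] (p : PMF α) (g : α → PMF β) (f : β → ℝ) :
    ev (p.bind g) f = ev p fun a => ev (g a) f := by
  simp only [ev, toReal_bind, sum_mul, mul_sum]
  rw [sum_comm]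
  exact sum_congr rfl fun a _ => sum_congr rfl fun b _ => by ring

theorem ev_pure (a : α) (f : α → ℝ) : ev (PMF.pure a) f = f a := by
  classical
  rw [ev, Finset.sum_eq_single a]
  · simp
  · intro b _ hb
    simp [hb]
  · simp

theorem ev_map {β : Type*} [Fintype β] (p : PMF α) (g : α → β) (f : β → ℝ) : ev (p.map g) f = ev p fun a => f (g a) := by
  rw [PMF.map, ev_bind]
  simp [Function.comp_apply, ev_pure]

open scoped Classical in
theorem ev_uniformOfFinset (s : Finset α) (hs : s.Nonempty) (f : α → ℝ) :
    ev (PMF.uniformOfFinset s hs) f = (s.card : ℝ)⁻¹ * ∑ a ∈ s, f a := by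
  rw [ev, mul_sum, ← sum_subset (subset_univ s)]
  · refine sum_congr rfl fun a ha => ?_
    rw [PMF.uniformOfFinset_apply_of_mem hs ha]
    simp
  · intro a _ ha
    rw [PMF.uniformOfFinset_apply_of_notMem hs ha]
    simp

theorem ev_uniformBool (f : Bool → ℝ) :
    ev (PMF.uniformOfFintype Bool) f = 1 / 2 * f true + 1 / 2 * f false := by
  simp [ev]

open scoped Classical in
theorem toOuterMeasure_toReal (p : PMF α) (t : Set α) :
    (p.toOuterMeasure t).toReal = ev p fun a => if a ∈ t then 1 else 0 := by
  rw [PMF.toOuterMeasure_apply_fintype, ENNReal.toReal_sum]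
  · refine sum_congr rfl fun a _ => ?_
    by_cases h : a ∈ t <;> simp [h]
  · intro a _
    by_cases h : a ∈ t <;> simp [h, p.apply_ne_top]

end Expectation

/-! ### Lower tail of the sampled weight of a cut -/

section Sampling

open scoped Classical

variable {V : Type*} [Fintype V]

/-- The law of the next edge to be sampled. -/
noncomputable def edgeLaw (A : AdaptiveScheme V) (w : Sym2 V → ℝ) (s : Finset (Sym2 V))
    (h : (pairs V \ s).Nonempty) : PMF (Sym2 V) :=
  (PMF.uniformOfFintype Bool).bind fun heads =>
    if heads then PMF.uniformOfFinset (pairs V \ s) h else A.pick s (observed w s)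

theorem ev_stepLaw (A : AdaptiveScheme V) (w : Sym2 V → ℝ) (s : Finset (Sym2 V))
    (h : (pairs V \ s).Nonempty) (f : Finset (Sym2 V) → ℝ) :
    ev (stepLaw A w s) f = ev (edgeLaw A w s h) fun e => f (insert e s) := by
  rw [stepLaw, dif_pos h, edgeLaw, ev_bind, ev_bind]
  simp only [ev_map]

theorem ev_edgeLaw (A : AdaptiveScheme V) (w : Sym2 V → ℝ) (s : Finset (Sym2 V))
    (h : (pairs V \ s).Nonempty) (f : Sym2 V → ℝ) :
    ev (edgeLaw A w s h) f =
      1 / 2 * (((pairs V \ s).card : ℝ)⁻¹ * ∑ e ∈ pairs V \ s, f e) +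
        1 / 2 * ev (A.pick s (observed w s)) f := by
  rw [edgeLaw, ev_bind, ev_uniformBool]
  simp [ev_uniformOfFinset]

theorem mem_of_mem_support_edgeLaw (A : AdaptiveScheme V) (w : Sym2 V → ℝ) (s : Finset (Sym2 V))
    (h : (pairs V \ s).Nonempty) {e : Sym2 V} (he : e ∈ (edgeLaw A w s h).support) :
    e ∈ pairs V \ s := by
  rw [edgeLaw, PMF.mem_support_bind_iff] at he
  obtain ⟨b, -, hb⟩ := he
  cases b
  · exact A.pick_unseen s _ h e (by simpa using hb)
  · simpa using hb

theorem stepLaw_of_not (A : AdaptiveScheme V) (w : Sym2 V → ℝ) (s : Finset (Sym2 V))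
    (h : ¬ (pairs V \ s).Nonempty) : stepLaw A w s = PMF.pure s := by
  rw [stepLaw, dif_neg h]

theorem mem_support_stepLaw (A : AdaptiveScheme V) (w : Sym2 V → ℝ) {s s' : Finset (Sym2 V)}
    (hs : s' ∈ (stepLaw A w s).support) : s ⊆ s' ∧ s'.card ≤ s.card + 1 := by
  by_cases h : (pairs V \ s).Nonempty
  · rw [stepLaw, dif_pos h, PMF.mem_support_bind_iff] at hs
    obtain ⟨b, -, hb⟩ := hs
    rw [PMF.mem_support_map_iff] at hb
    obtain ⟨e, -, rfl⟩ := hb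
    exact ⟨subset_insert _ _, card_insert_le _ _⟩
  · rw [stepLaw_of_not A w s h] at hs
    simp at hs
    subst hs
    simp

theorem card_le_of_mem_support_sampleLaw (A : AdaptiveScheme V) (w : Sym2 V → ℝ) (m : ℕ) :
    ∀ {s : Finset (Sym2 V)}, s ∈ (sampleLaw A w m).support → s.card ≤ m := by
  induction m with
  | zero => intro s hs; simp [sampleLaw] at hs; simp [hs]
  | succ m ih =>
    intro s hs
    rw [sampleLaw, PMF.mem_support_bind_iff] at hs
    obtain ⟨s', h1, h2⟩ := hs
    have := ih h1
    have := (mem_support_stepLaw A w h2).2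
    omega

/-- From `exp x ≥ 1 + x` and (1 + x)(1 - x/2) ≥ 1 on [0, 1]. -/
theorem one_sub_exp_neg_ge {x : ℝ} (h0 : 0 ≤ x) (h1 : x ≤ 1) : Real.exp (-x) ≤ 1 - x / 2 := by
  have h2 := Real.add_one_le_exp x
  rw [Real.exp_neg]
  rw [inv_le_comm₀ (Real.exp_pos x) (by linarith)]
  refine le_trans ?_ h2
  rw [inv_le_iff_one_le_mul₀ (by linarith)]
  nlinarith

/-- The expected effect of one sampling step on the sampled weight of `T`. -/
theorem ev_stepLaw_exp_neg_le (A : AdaptiveScheme V) (w : Sym2 V → ℝ) (T : Finset (Sym2 V))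
    (hT : T ⊆ pairs V) (hw : ∀ e ∈ T, w e ∈ Set.Icc (0 : ℝ) 1) (s : Finset (Sym2 V))
    (hs : ∑ e ∈ T ∩ s, w e < (∑ e ∈ T, w e) / 2) :
    ev (stepLaw A w s) (fun s => Real.exp (-∑ e ∈ T ∩ s, w e)) ≤
      Real.exp (-((∑ e ∈ T, w e) / (8 * (pairs V).card))) *
        Real.exp (-∑ e ∈ T ∩ s, w e) := by
  set c := ∑ e ∈ T, w e with hc
  set X := ∑ e ∈ T ∩ s, w e with hX
  have hc0 : 0 ≤ c := sum_nonneg fun e he => (hw e he).1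
  have hsplit : ∑ e ∈ T \ s, w e = c - X := by
    rw [hc, hX, ← sum_sdiff (inter_subset_left (s₁ := T) (s₂ := s)), sdiff_inter_self_left]
    ring
  -- The unseen weight `c - X` of `T` exceeds `c / 2 ≥ 0`.
  have hne : (pairs V \ s).Nonempty := by
    by_contra h
    rw [not_nonempty_iff_eq_empty] at h
    have : T \ s = ∅ := subset_empty.1 (h ▸ sdiff_subset_sdiff hT (le_refl s))
    rw [this, sum_empty] at hsplit
    linarith
  have hU : (0 : ℝ) < (pairs V \ s).card := by exact_mod_cast hne.card_pos
  have hUN : ((pairs V \ s).card : ℝ) ≤ (pairs V).card := by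
    exact_mod_cast card_le_card sdiff_subset
  have hN : (0 : ℝ) < (pairs V).card := hU.trans_le hUN
  have hins : ∀ e ∈ pairs V \ s, Real.exp (-∑ e ∈ T ∩ insert e s, w e) ≤
      Real.exp (-X) * (1 - if e ∈ T then w e / 2 else 0) := by
    intro e he
    have hes : e ∉ s := (Finset.mem_sdiff.1 he).2
    by_cases heT : e ∈ T
    · rw [inter_insert_of_mem heT, sum_insert (by simp [hes]), neg_add_rev, Real.exp_add,
        if_pos heT]
      exact mul_le_mul_of_nonneg_left (one_sub_exp_neg_ge (hw e heT).1 (hw e heT).2)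
        (Real.exp_nonneg _)
    · rw [inter_insert_of_notMem heT, if_neg heT]
      simp [hX]
  have hsum : ∑ e ∈ pairs V \ s, (if e ∈ T then w e / 2 else 0) = (c - X) / 2 := by
    rw [← sum_filter, ← sum_div, ← hsplit]
    congr 1
    refine sum_congr ?_ fun _ _ => rfl
    ext e
    simp only [Finset.mem_filter, Finset.mem_sdiff]
    constructor
    · rintro ⟨⟨_, h1⟩, h2⟩; exact ⟨h2, h1⟩
    · rintro ⟨h1, h2⟩; exact ⟨⟨hT h1, h2⟩, h1⟩
  rw [ev_stepLaw A w s hne, ev_edgeLaw]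
  -- Heads: a uniform unseen pair carries expected weight at least (c/2)/N, and each unit of weight
  -- gains a factor 1/2 from `one_sub_exp_neg_ge`.
  have h1 : ((pairs V \ s).card : ℝ)⁻¹ * ∑ e ∈ pairs V \ s, Real.exp (-∑ e ∈ T ∩ insert e s, w e) ≤
      Real.exp (-X) * (1 - c / (4 * (pairs V).card)) := by
    calc _ ≤ ((pairs V \ s).card : ℝ)⁻¹ *
          ∑ e ∈ pairs V \ s, Real.exp (-X) * (1 - if e ∈ T then w e / 2 else 0) :=
          mul_le_mul_of_nonneg_left (sum_le_sum hins) (by positivity)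
      _ = Real.exp (-X) * (1 - (c - X) / 2 / (pairs V \ s).card) := by
          rw [← mul_sum, sum_sub_distrib, hsum]
          simp
          field_simp
      _ ≤ _ := by
          refine mul_le_mul_of_nonneg_left ?_ (Real.exp_nonneg _)
          have : c / (4 * (pairs V).card) ≤ (c - X) / 2 / (pairs V \ s).card := by
            rw [← div_div]
            exact div_le_div₀ (by linarith) (by linarith) hU hUN
          linarith
  -- Tails: whatever the scheme picks, the sampled weight does not decrease.
  have h2 : ev (A.pick s (observed w s)) (fun e => Real.exp (-∑ e ∈ T ∩ insert e s, w e)) ≤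
      Real.exp (-X) := by
    rw [← ev_const (A.pick s (observed w s)) (Real.exp (-X))]
    refine ev_mono _ fun e => Real.exp_le_exp.2 (neg_le_neg ?_)
    exact sum_le_sum_of_subset_of_nonneg
      (inter_subset_inter_left (subset_insert e s)) fun e he _ => (hw e (mem_inter.1 he).1).1
  have h3 : 1 - c / (8 * (pairs V).card) ≤ Real.exp (-(c / (8 * (pairs V).card))) :=
    Real.one_sub_le_exp_neg _
  have h4 : c / (4 * (pairs V).card) = 2 * (c / (8 * (pairs V).card)) := by
    field_simp
    ring
  rw [h4] at h1
  have h5 := mul_le_mul_of_nonneg_right h3 (Real.exp_nonneg (-X))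
  linarith

/-- The one-step decay holds only below half the weight, so the process is killed beyond it. Sampled
weight never decreases, so a killed path stays killed and the decay factors multiply. -/
theorem ev_sampleLaw_exp_neg_le (A : AdaptiveScheme V) (w : Sym2 V → ℝ) (T : Finset (Sym2 V))
    (hT : T ⊆ pairs V) (hw : ∀ e ∈ T, w e ∈ Set.Icc (0 : ℝ) 1) (m : ℕ) :
    ev (sampleLaw A w m) (fun s => if ∑ e ∈ T ∩ s, w e < (∑ e ∈ T, w e) / 2 then
        Real.exp (-∑ e ∈ T ∩ s, w e) else 0) ≤
      Real.exp (-(m * ((∑ e ∈ T, w e) / (8 * (pairs V).card)))) := by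
  set c := ∑ e ∈ T, w e with hc
  induction m with
  | zero =>
    rw [sampleLaw, ev_pure]
    split_ifs <;> simp
  | succ m ih =>
    rw [sampleLaw, ev_bind]
    calc _ ≤ ev (sampleLaw A w m) fun s => Real.exp (-(c / (8 * (pairs V).card))) *
          (if ∑ e ∈ T ∩ s, w e < c / 2 then Real.exp (-∑ e ∈ T ∩ s, w e) else 0) := by
          refine ev_mono _ fun s => ?_
          by_cases hs : ∑ e ∈ T ∩ s, w e < c / 2
          · rw [if_pos hs]
            refine le_trans (ev_mono _ fun s => ?_) (ev_stepLaw_exp_neg_le A w T hT hw s hs)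
            split_ifs
            · exact le_rfl
            · exact Real.exp_nonneg _
          · rw [if_neg hs, mul_zero]
            refine le_of_le_of_eq (ev_mono_of_support (g := fun _ => 0) _ fun s' hs' => ?_)
              (ev_const _ 0)
            rw [if_neg]
            refine fun h => hs (lt_of_le_of_lt ?_ h)
            exact sum_le_sum_of_subset_of_nonneg
              (inter_subset_inter_left (mem_support_stepLaw A w hs').1)
              fun e he _ => (hw e (mem_inter.1 he).1).1
      _ ≤ Real.exp (-(c / (8 * (pairs V).card))) *
          Real.exp (-(m * (c / (8 * (pairs V).card)))) := by
          rw [ev_const_mul]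
          exact mul_le_mul_of_nonneg_left ih (Real.exp_nonneg _)
      _ = _ := by
          rw [← Real.exp_add]
          push_cast
          ring_nf

/-- Lower tail of the sampled weight of a set of edges. -/
theorem ev_sampleLaw_lt_le (A : AdaptiveScheme V) (w : Sym2 V → ℝ) (T : Finset (Sym2 V))
    (hT : T ⊆ pairs V) (hw : ∀ e ∈ T, w e ∈ Set.Icc (0 : ℝ) 1) (m : ℕ) {x : ℝ}
    (hx : x ≤ (∑ e ∈ T, w e) / 2) :
    ev (sampleLaw A w m) (fun s => if ∑ e ∈ T ∩ s, w e < x then 1 else 0) ≤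
      Real.exp x * Real.exp (-(m * ((∑ e ∈ T, w e) / (8 * (pairs V).card)))) := by
  refine le_trans ?_ (mul_le_mul_of_nonneg_left (ev_sampleLaw_exp_neg_le A w T hT hw m)
    (Real.exp_nonneg x))
  rw [← ev_const_mul]
  refine ev_mono _ fun s => ?_
  by_cases hs : ∑ e ∈ T ∩ s, w e < x
  · rw [if_pos hs, if_pos (hs.trans_le hx), ← Real.exp_add]
    exact Real.one_le_exp (by linarith)
  · rw [if_neg hs]
    split_ifs
    · positivity
    · simp

end Sampling

/-! ### Exchangeability of unseen pairs and the number of sampled noise edges -/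

section Noise

open scoped Classical

variable {V : Type*}

theorem observed_congr {w w' : Sym2 V → ℝ} {s : Finset (Sym2 V)} (h : ∀ e ∈ s, w e = w' e) :
    observed w s = observed w' s := by
  ext e
  unfold observed
  split_ifs with he
  · exact h e he
  · rfl

theorem graphWeight_congr {k : ℕ} (cl : V → Fin k) (win : Sym2 V → ℝ)
    {E E' s : Finset (Sym2 V)} (h : E ∩ s = E' ∩ s) :
    ∀ e ∈ s, graphWeight cl win E e = graphWeight cl win E' e := by
  intro e he
  have : e ∈ E ↔ e ∈ E' := by
    have := congrArg (fun T => e ∈ T) h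
    simpa [he] using this
  simp [graphWeight, this]

theorem map_swap {k : ℕ} {cl : V → Fin k} {e e' : Sym2 V} (h : e.map cl = e'.map cl)
    (x : Sym2 V) : (Equiv.swap e e' x).map cl = x.map cl := by
  by_cases h1 : x = e
  · subst h1; rw [Equiv.swap_apply_left, h]
  · by_cases h2 : x = e'
    · subst h2; rw [Equiv.swap_apply_right, h]
    · rw [Equiv.swap_apply_of_ne_of_ne h1 h2]

theorem mem_map_swap {e e' : Sym2 V} {E : Finset (Sym2 V)} (x : Sym2 V) :
    x ∈ E.map (Equiv.swap e e').toEmbedding ↔ Equiv.swap e e' x ∈ E := by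
  rw [Finset.mem_map_equiv, Equiv.symm_swap]

variable [Fintype V]

theorem stepLaw_congr (A : AdaptiveScheme V) {w w' : Sym2 V → ℝ} {s : Finset (Sym2 V)}
    (h : ∀ e ∈ s, w e = w' e) : stepLaw A w s = stepLaw A w' s := by
  unfold stepLaw
  rw [observed_congr h]

theorem edgeLaw_congr (A : AdaptiveScheme V) {w w' : Sym2 V → ℝ} {s : Finset (Sym2 V)}
    (h : ∀ e ∈ s, w e = w' e) (hs : (pairs V \ s).Nonempty) :
    edgeLaw A w s hs = edgeLaw A w' s hs := by
  unfold edgeLaw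
  rw [observed_congr h]

/-- The probability that the edges of `s` are sampled depends only on their weights. -/
theorem sampleLaw_congr (A : AdaptiveScheme V) {w w' : Sym2 V → ℝ} (m : ℕ) :
    ∀ {s : Finset (Sym2 V)}, (∀ e ∈ s, w e = w' e) → sampleLaw A w m s = sampleLaw A w' m s := by
  induction m with
  | zero => intro s _; rfl
  | succ m ih =>
    intro s h
    rw [sampleLaw, sampleLaw, PMF.bind_apply, PMF.bind_apply]
    refine tsum_congr fun s' => ?_
    -- Sampled sets only grow, so only histories inside `s` contribute, and these reveal weights on
    -- `s` only.
    by_cases hs : s' ⊆ s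
    · rw [ih fun e he => h e (hs he), stepLaw_congr A fun e he => h e (hs he)]
    · have h0 : ∀ w : Sym2 V → ℝ, stepLaw A w s' s = 0 := fun w => by
        by_contra hne
        exact hs (mem_support_stepLaw A w ((PMF.mem_support_iff _ _).2 hne)).1
      rw [h0, h0, mul_zero, mul_zero]

theorem mem_noiseSets {k : ℕ} {cl : V → Fin k} {d : Sym2 (Fin k) → ℕ} {E : Finset (Sym2 V)} :
    E ∈ noiseSets cl d ↔ (∀ e ∈ E, ¬ (e.map cl).IsDiag) ∧
      ∀ i j : Fin k, i ≠ j → (E.filter fun e => e.map cl = s(i, j)).card = d s(i, j) := by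
  simp [noiseSets]

theorem map_swap_mem_noiseSets {k : ℕ} {cl : V → Fin k} {d : Sym2 (Fin k) → ℕ} {e e' : Sym2 V}
    (h : e.map cl = e'.map cl) {E : Finset (Sym2 V)} (hE : E ∈ noiseSets cl d) :
    E.map (Equiv.swap e e').toEmbedding ∈ noiseSets cl d := by
  rw [mem_noiseSets] at hE ⊢
  refine ⟨fun x hx => ?_, fun i j hij => ?_⟩
  · rw [mem_map_swap] at hx
    rw [← map_swap h]
    exact hE.1 _ hx
  · rw [← hE.2 i j hij, Finset.filter_map, card_map]
    congr 1
    refine filter_congr fun x _ => ?_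
    simp only [Function.comp_apply, Equiv.coe_toEmbedding, map_swap h]

/-- Two unseen edges between the same clusters are equally likely to be noise edges. -/
theorem sum_noiseSets_swap {k : ℕ} (cl : V → Fin k) (d : Sym2 (Fin k) → ℕ)
    (G : Finset (Sym2 V) → ℝ) (s : Finset (Sym2 V))
    (hG : ∀ E E' : Finset (Sym2 V), E ∩ s = E' ∩ s → G E = G E') {e e' : Sym2 V}
    (h : e.map cl = e'.map cl) (he : e ∉ s) (he' : e' ∉ s) :
    ∑ E ∈ noiseSets cl d, G E * (if e ∈ E then 1 else 0) =
      ∑ E ∈ noiseSets cl d, G E * (if e' ∈ E then 1 else 0) := by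
  have hinv : ∀ E : Finset (Sym2 V), (E.map (Equiv.swap e e').toEmbedding).map
      (Equiv.swap e e').toEmbedding = E := by
    intro E
    ext x
    rw [mem_map_swap, mem_map_swap, Equiv.swap_apply_self]
  -- Reindex by the transposition of `e` and `e'`. It preserves the noise sets because both pairs
  -- join the same clusters, and preserves `G` because it fixes `s` pointwise.
  refine sum_nbij' (fun E => E.map (Equiv.swap e e').toEmbedding)
    (fun E => E.map (Equiv.swap e e').toEmbedding)
    (fun E hE => map_swap_mem_noiseSets h hE) (fun E hE => map_swap_mem_noiseSets h hE)
    (fun E _ => hinv E) (fun E _ => hinv E) fun E _ => ?_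
  have h1 : G (E.map (Equiv.swap e e').toEmbedding) = G E := by
    refine hG _ _ ?_
    ext x
    simp only [mem_inter, mem_map_swap]
    refine and_congr_left fun hx => ?_
    rw [Equiv.swap_apply_of_ne_of_ne]
    · rintro rfl; exact he hx
    · rintro rfl; exact he' hx
  simp only [h1, mem_map_swap, Equiv.swap_apply_right]

/-- The probability that an unseen edge between clusters is a noise edge is small. -/
theorem sum_noiseSets_mem_le {k : ℕ} (cl : V → Fin k) (d : Sym2 (Fin k) → ℕ)
    (G : Finset (Sym2 V) → ℝ) (hG0 : ∀ E, 0 ≤ G E) (s : Finset (Sym2 V))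
    (hG : ∀ E E' : Finset (Sym2 V), E ∩ s = E' ∩ s → G E = G E') {B D : ℝ} (hB : 0 < B)
    {i j : Fin k} (hij : i ≠ j) (hD : (d s(i, j) : ℝ) ≤ D)
    (hcard : B ≤ ((univ.filter fun x : Sym2 V => x.map cl = s(i, j)).card : ℝ))
    (hs : (s.card : ℝ) ≤ B / 2) {e : Sym2 V} (he : e ∉ s) (heij : e.map cl = s(i, j)) :
    ∑ E ∈ noiseSets cl d, G E * (if e ∈ E then 1 else 0) ≤
      2 * D / B * ∑ E ∈ noiseSets cl d, G E := by
  set U := (univ.filter fun x : Sym2 V => x.map cl = s(i, j)) \ s with hU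
  set L := ∑ E ∈ noiseSets cl d, G E * (if e ∈ E then (1 : ℝ) else 0) with hL
  have hL0 : 0 ≤ L := sum_nonneg fun E _ => mul_nonneg (hG0 E) (by split_ifs <;> simp)
  have hUc : B / 2 ≤ U.card := by
    have h1 : (univ.filter fun x : Sym2 V => x.map cl = s(i, j)).card ≤ U.card + s.card := by
      rw [hU]
      have := le_card_sdiff s (univ.filter fun x : Sym2 V => x.map cl = s(i, j))
      omega
    have h2 : ((univ.filter fun x : Sym2 V => x.map cl = s(i, j)).card : ℝ) ≤
      U.card + s.card := by exact_mod_cast h1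
    linarith
  -- All unseen pairs `x` of the block give the same sum `L`; adding them up counts the unseen noise
  -- edges of the block, of which there are at most `D`.
  have h1 : (U.card : ℝ) * L = ∑ E ∈ noiseSets cl d, G E * ((U.filter fun x => x ∈ E).card : ℝ) := by
    calc (U.card : ℝ) * L = ∑ x ∈ U, ∑ E ∈ noiseSets cl d, G E * (if x ∈ E then 1 else 0) := by
          rw [← nsmul_eq_mul, ← sum_const]
          refine sum_congr rfl fun x hx => ?_
          rw [hU, Finset.mem_sdiff, mem_filter] at hx
          exact sum_noiseSets_swap cl d G s hG (heij.trans hx.1.2.symm) he hx.2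
      _ = _ := by
          rw [sum_comm]
          refine sum_congr rfl fun E _ => ?_
          rw [← mul_sum, sum_boole]
  have h2 : (U.card : ℝ) * L ≤ D * ∑ E ∈ noiseSets cl d, G E := by
    rw [h1, mul_sum]
    refine sum_le_sum fun E hE => ?_
    rw [mul_comm]
    refine mul_le_mul_of_nonneg_right (le_trans ?_ hD) (hG0 E)
    rw [← (mem_noiseSets.1 hE).2 i j hij]
    refine Nat.cast_le.2 (card_le_card fun x hx => ?_)
    rw [hU, mem_filter, Finset.mem_sdiff, mem_filter] at hx
    exact mem_filter.2 ⟨hx.2, hx.1.1.2⟩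
  have h3 : B / 2 * L ≤ D * ∑ E ∈ noiseSets cl d, G E :=
    (mul_le_mul_of_nonneg_right hUc hL0).trans h2
  rw [div_mul_eq_mul_div, le_div_iff₀ hB]
  linarith

theorem card_block_ge {k : ℕ} (cl : V → Fin k) {i j : Fin k} (hij : i ≠ j) :
    (cluster cl i).card * (cluster cl j).card ≤
      (univ.filter fun x : Sym2 V => x.map cl = s(i, j)).card := by
  rw [← card_product]
  refine card_le_card_of_injOn (fun p => s(p.1, p.2)) ?_ ?_
  · rintro ⟨u, v⟩ h
    simp only [coe_product, Set.mem_prod, mem_coe, cluster, mem_filter, mem_univ, true_and] at h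
    simp [h.1, h.2]
  · rintro ⟨u, v⟩ h ⟨u', v'⟩ h' heq
    simp only [coe_product, Set.mem_prod, mem_coe, cluster, mem_filter, mem_univ, true_and] at h h'
    rcases Sym2.eq_iff.1 heq with ⟨h1, h2⟩ | ⟨h1, h2⟩
    · exact Prod.ext h1 h2
    · exact absurd (h.1.symm.trans ((congrArg cl h1).trans h'.2)) hij

/-- The conditional probability that the next sampled edge is a noise edge. -/
noncomputable def hitProb (A : AdaptiveScheme V) (w : Sym2 V → ℝ) (E s : Finset (Sym2 V)) : ℝ :=
  if h : (pairs V \ s).Nonempty then ev (edgeLaw A w s h) (fun e => if e ∈ E then 1 else 0) else 0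

/-- A step adds a fresh pair, so the exponent grows by 0 or 1 and the increment is `(r - 1) r ^
card` on a hit. The base is kept general for the later choices `r = exp 1` and `r = 0`. -/
theorem ev_stepLaw_pow_card (A : AdaptiveScheme V) (w : Sym2 V → ℝ) (E s : Finset (Sym2 V))
    (r : ℝ) : ev (stepLaw A w s) (fun s => r ^ (E ∩ s).card) =
      r ^ (E ∩ s).card + (r - 1) * (r ^ (E ∩ s).card * hitProb A w E s) := by
  by_cases h : (pairs V \ s).Nonempty
  · rw [ev_stepLaw A w s h, hitProb, dif_pos h, ← ev_const_mul, ← ev_const_mul,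
      ← ev_const (edgeLaw A w s h) (r ^ (E ∩ s).card), ← ev_add]
    refine ev_congr_of_support _ fun e he => ?_
    have hes := (Finset.mem_sdiff.1 (mem_of_mem_support_edgeLaw A w s h he)).2
    rw [ev_const]
    by_cases heE : e ∈ E
    · rw [inter_insert_of_mem heE, card_insert_of_notMem (by simp [hes]), pow_succ, if_pos heE]
      ring
    · rw [inter_insert_of_notMem heE, if_neg heE]
      ring
  · rw [stepLaw_of_not A w s h, ev_pure, hitProb, dif_neg h]
    ring

/-- The total over all noise sets of the generating function of the number of sampled noise
edges. -/
noncomputable def noiseGen {k : ℕ} (cl : V → Fin k) (win : Sym2 V → ℝ) (d : Sym2 (Fin k) → ℕ)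
    (A : AdaptiveScheme V) (r : ℝ) (m : ℕ) : ℝ :=
  ∑ E ∈ noiseSets cl d, ev (sampleLaw A (graphWeight cl win E) m) fun s => r ^ (E ∩ s).card

/-- The total over all noise sets of the increments of `noiseGen`. -/
noncomputable def noiseInc {k : ℕ} (cl : V → Fin k) (win : Sym2 V → ℝ) (d : Sym2 (Fin k) → ℕ)
    (A : AdaptiveScheme V) (r : ℝ) (m : ℕ) : ℝ :=
  ∑ E ∈ noiseSets cl d, ev (sampleLaw A (graphWeight cl win E) m) fun s =>
    r ^ (E ∩ s).card * hitProb A (graphWeight cl win E) E s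

theorem noiseGen_zero {k : ℕ} (cl : V → Fin k) (win : Sym2 V → ℝ) (d : Sym2 (Fin k) → ℕ)
    (A : AdaptiveScheme V) (r : ℝ) : noiseGen cl win d A r 0 = (noiseSets cl d).card := by
  simp [noiseGen, sampleLaw, ev_pure]

theorem noiseGen_succ {k : ℕ} (cl : V → Fin k) (win : Sym2 V → ℝ) (d : Sym2 (Fin k) → ℕ)
    (A : AdaptiveScheme V) (r : ℝ) (m : ℕ) : noiseGen cl win d A r (m + 1) =
      noiseGen cl win d A r m + (r - 1) * noiseInc cl win d A r m := by
  unfold noiseGen noiseInc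
  rw [mul_sum, ← sum_add_distrib]
  refine sum_congr rfl fun E _ => ?_
  rw [sampleLaw, ev_bind, ← ev_const_mul, ← ev_add]
  simp only [ev_stepLaw_pow_card]

/-- For a fixed sampled set `s` and next pair `e`, the joint probability of reaching `s` and then
drawing `e` depends on the noise set only through its intersection with `s`. Thus
`sum_noiseSets_mem_le` applies to each `(s, e)`, and no conditional laws are needed. -/
theorem noiseInc_le {k : ℕ} (cl : V → Fin k) (win : Sym2 V → ℝ) (d : Sym2 (Fin k) → ℕ)
    (A : AdaptiveScheme V) {r : ℝ} (hr : 0 ≤ r) {B D : ℝ} (hB : 0 < B) (hD0 : 0 ≤ D)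
    (hD : ∀ i j : Fin k, i ≠ j → (d s(i, j) : ℝ) ≤ D)
    (hcard : ∀ i j : Fin k, i ≠ j →
      B ≤ ((univ.filter fun x : Sym2 V => x.map cl = s(i, j)).card : ℝ))
    {m : ℕ} (hm : (m : ℝ) ≤ B / 2) :
    noiseInc cl win d A r m ≤ 2 * D / B * noiseGen cl win d A r m := by
  unfold noiseInc noiseGen ev
  rw [sum_comm, sum_comm (s := noiseSets cl d), mul_sum]
  refine sum_le_sum fun s _ => ?_
  by_cases hs : s.card ≤ m
  swap
  · have h0 : ∀ E, sampleLaw A (graphWeight cl win E) m s = 0 := fun E => by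
      by_contra hne
      exact hs (card_le_of_mem_support_sampleLaw A _ m ((PMF.mem_support_iff _ _).2 hne))
    simp [h0]
  by_cases hne : (pairs V \ s).Nonempty
  swap
  · simp only [hitProb, dif_neg hne, mul_zero, sum_const_zero]
    exact mul_nonneg (by positivity) (sum_nonneg fun E _ =>
      mul_nonneg ENNReal.toReal_nonneg (pow_nonneg hr _))
  set G : Sym2 V → Finset (Sym2 V) → ℝ := fun e E =>
    (sampleLaw A (graphWeight cl win E) m s).toReal * r ^ (E ∩ s).card *
      (edgeLaw A (graphWeight cl win E) s hne e).toReal with hGdef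
  have hG0 : ∀ e E, 0 ≤ G e E := fun e E =>
    mul_nonneg (mul_nonneg ENNReal.toReal_nonneg (pow_nonneg hr _)) ENNReal.toReal_nonneg
  have h1 : ∑ E ∈ noiseSets cl d, (sampleLaw A (graphWeight cl win E) m s).toReal *
        (r ^ (E ∩ s).card * hitProb A (graphWeight cl win E) E s) =
      ∑ e, ∑ E ∈ noiseSets cl d, G e E * (if e ∈ E then 1 else 0) := by
    rw [sum_comm]
    refine sum_congr rfl fun E _ => ?_
    rw [hitProb, dif_pos hne, ev, ← mul_assoc, mul_sum]
    refine sum_congr rfl fun e _ => ?_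
    simp only [hGdef]
    ring
  have h2 : ∑ E ∈ noiseSets cl d, (sampleLaw A (graphWeight cl win E) m s).toReal *
        r ^ (E ∩ s).card = ∑ e, ∑ E ∈ noiseSets cl d, G e E := by
    rw [sum_comm]
    refine sum_congr rfl fun E _ => ?_
    simp only [hGdef]
    rw [← mul_sum, sum_toReal, mul_one]
  rw [h1, h2, mul_sum]
  refine sum_le_sum fun e _ => ?_
  have hRHS : 0 ≤ 2 * D / B * ∑ E ∈ noiseSets cl d, G e E :=
    mul_nonneg (by positivity) (sum_nonneg fun E _ => hG0 e E)
  by_cases he : e ∈ s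
  · refine le_of_eq_of_le (sum_eq_zero fun E _ => ?_) hRHS
    have : edgeLaw A (graphWeight cl win E) s hne e = 0 := by
      by_contra h
      exact (Finset.mem_sdiff.1 (mem_of_mem_support_edgeLaw A _ s hne
        ((PMF.mem_support_iff _ _).2 h))).2 he
    simp [hGdef, this]
  by_cases hdiag : (e.map cl).IsDiag
  · refine le_of_eq_of_le (sum_eq_zero fun E hE => ?_) hRHS
    rw [if_neg, mul_zero]
    exact fun h => (mem_noiseSets.1 hE).1 e h hdiag
  obtain ⟨i, j, hij⟩ : ∃ i j, e.map cl = s(i, j) := by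
    induction e.map cl with
    | _ i j => exact ⟨i, j, rfl⟩
  have hne' : i ≠ j := by
    rintro rfl
    exact hdiag (by rw [hij]; rfl)
  refine sum_noiseSets_mem_le cl d (G e) (hG0 e) s ?_ hB hne' (hD i j hne') (hcard i j hne') ?_
    he hij
  · intro E E' h
    have hw := graphWeight_congr cl win h
    simp only [hGdef]
    rw [sampleLaw_congr A m hw, edgeLaw_congr A hw, h]
  · exact le_trans (by exact_mod_cast hs) hm

/-- The moment generating function of the number of sampled noise edges. -/
theorem noiseGen_le {k : ℕ} (cl : V → Fin k) (win : Sym2 V → ℝ) (d : Sym2 (Fin k) → ℕ)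
    (A : AdaptiveScheme V) {r : ℝ} (hr : 1 ≤ r) {B D : ℝ} (hB : 0 < B) (hD0 : 0 ≤ D)
    (hD : ∀ i j : Fin k, i ≠ j → (d s(i, j) : ℝ) ≤ D)
    (hcard : ∀ i j : Fin k, i ≠ j →
      B ≤ ((univ.filter fun x : Sym2 V => x.map cl = s(i, j)).card : ℝ))
    (m : ℕ) (hm : (m : ℝ) ≤ B / 2) :
    noiseGen cl win d A r m ≤
      (1 + (r - 1) * (2 * D / B)) ^ m * (noiseSets cl d).card := by
  induction m with
  | zero => simp [noiseGen_zero]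
  | succ m ih =>
    push_cast at hm
    have h1 := ih (by linarith)
    have h2 := noiseInc_le cl win d A (zero_le_one.trans hr) hB hD0 hD hcard (m := m)
      (by linarith)
    have h3 := mul_le_mul_of_nonneg_left h2 (sub_nonneg.2 hr)
    have h4 : 0 ≤ 1 + (r - 1) * (2 * D / B) := by
      have := mul_nonneg (sub_nonneg.2 hr) (show 0 ≤ 2 * D / B by positivity)
      linarith
    have h5 := mul_le_mul_of_nonneg_left h1 h4
    rw [noiseGen_succ, pow_succ]
    linarith

/-- The probability that no noise edge is sampled. -/
theorem noiseGen_zero_ge {k : ℕ} (cl : V → Fin k) (win : Sym2 V → ℝ) (d : Sym2 (Fin k) → ℕ)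
    (A : AdaptiveScheme V) {B D : ℝ} (hB : 0 < B) (hD0 : 0 ≤ D) (hDB : 2 * D / B ≤ 1)
    (hD : ∀ i j : Fin k, i ≠ j → (d s(i, j) : ℝ) ≤ D)
    (hcard : ∀ i j : Fin k, i ≠ j →
      B ≤ ((univ.filter fun x : Sym2 V => x.map cl = s(i, j)).card : ℝ))
    (m : ℕ) (hm : (m : ℝ) ≤ B / 2) :
    (1 - 2 * D / B) ^ m * (noiseSets cl d).card ≤ noiseGen cl win d A 0 m := by
  induction m with
  | zero => simp [noiseGen_zero]
  | succ m ih =>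
    push_cast at hm
    have h1 := ih (by linarith)
    -- With `r = 0` the power is the indicator that no noise edge was sampled, and `r - 1 = -1`
    -- turns the upper bound on the increment into a lower bound on the probability.
    have h2 := noiseInc_le cl win d A le_rfl hB hD0 hD hcard (m := m) (by linarith)
    have h5 := mul_le_mul_of_nonneg_left h1 (sub_nonneg.2 hDB)
    rw [noiseGen_succ, pow_succ]
    linarith

end Noise

/-! ### Cuts as edge sets, and basic counts -/

section Cuts

open scoped Classical

variable {V : Type*}

/-- The edges between `S` and `U \ S`. -/
noncomputable def cutEdges (U S : Finset V) : Finset (Sym2 V) :=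
  (S ×ˢ (U \ S)).image fun p => s(p.1, p.2)

theorem mem_cutEdges {U S : Finset V} {e : Sym2 V} :
    e ∈ cutEdges U S ↔ ∃ u ∈ S, ∃ v ∈ U \ S, e = s(u, v) := by
  simp only [cutEdges, mem_image, Prod.exists, mem_product]
  constructor
  · rintro ⟨u, v, ⟨hu, hv⟩, rfl⟩; exact ⟨u, hu, v, hv, rfl⟩
  · rintro ⟨u, hu, v, hv, rfl⟩; exact ⟨u, v, ⟨hu, hv⟩, rfl⟩

theorem cutWeight_eq_sum (w : Sym2 V → ℝ) (U S : Finset V) :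
    cutWeight w U S = ∑ e ∈ cutEdges U S, w e := by
  rw [cutEdges, sum_image, sum_product]
  · rfl
  · rintro ⟨u, v⟩ h ⟨u', v'⟩ h' heq
    simp only [coe_product, Set.mem_prod, mem_coe, Finset.mem_sdiff] at h h'
    rcases Sym2.eq_iff.1 heq with ⟨h1, h2⟩ | ⟨h1, h2⟩
    · exact Prod.ext h1 h2
    · have h1' : u = v' := h1
      exact absurd (h1' ▸ h.1) h'.2.2

theorem cutWeight_observed (w : Sym2 V → ℝ) (s : Finset (Sym2 V)) (U S : Finset V) :
    cutWeight (observed w s) U S = ∑ e ∈ cutEdges U S ∩ s, w e := by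
  rw [cutWeight_eq_sum, ← filter_mem_eq_inter, sum_filter]
  rfl

theorem cutEdges_subset_pairs [Fintype V] (U S : Finset V) : cutEdges U S ⊆ pairs V := by
  intro e he
  obtain ⟨u, hu, v, hv, rfl⟩ := mem_cutEdges.1 he
  simp only [pairs, mem_filter, mem_univ, true_and, Sym2.mk_isDiag_iff]
  rintro rfl
  exact (Finset.mem_sdiff.1 hv).2 hu

theorem graphWeight_of_mem_cutEdges [Fintype V] {k : ℕ} (cl : V → Fin k) (win : Sym2 V → ℝ)
    (E : Finset (Sym2 V)) {i : Fin k} {S : Finset V} (hS : S ⊆ cluster cl i) {e : Sym2 V}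
    (he : e ∈ cutEdges (cluster cl i) S) : graphWeight cl win E e = win e := by
  obtain ⟨u, hu, v, hv, rfl⟩ := mem_cutEdges.1 he
  have h1 : cl u = i := (mem_filter.1 (hS hu)).2
  have h2 : cl v = i := (mem_filter.1 (Finset.mem_sdiff.1 hv).1).2
  rw [graphWeight, if_pos]
  simp [h1, h2]

/-- A cut that splits no cluster meets only pairs between clusters, which weigh 1 on noise edges and
0 otherwise. The bound is uniform in `I`, so no union over outer cuts is needed. -/
theorem cutWeight_outer_le [Fintype V] {k : ℕ} (cl : V → Fin k) (win : Sym2 V → ℝ)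
    (E s : Finset (Sym2 V)) (I : Finset (Fin k)) :
    cutWeight (observed (graphWeight cl win E) s) univ (univ.filter fun v => cl v ∈ I) ≤
      (E ∩ s).card := by
  rw [cutWeight_observed]
  calc _ ≤ ∑ e ∈ cutEdges univ (univ.filter fun v => cl v ∈ I) ∩ s,
        (if e ∈ E then (1 : ℝ) else 0) := by
        refine sum_le_sum fun e he => ?_
        obtain ⟨u, hu, v, hv, rfl⟩ := mem_cutEdges.1 (mem_inter.1 he).1
        rw [graphWeight, if_neg]
        simp only [Sym2.map_mk, Sym2.mk_isDiag_iff]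
        intro h
        simp only [mem_filter, mem_univ, true_and, Finset.mem_sdiff] at hu hv
        exact hv (h ▸ hu)
    _ = ((cutEdges univ (univ.filter fun v => cl v ∈ I) ∩ s).filter (fun e => e ∈ E)).card := by
        rw [sum_boole]
    _ ≤ _ := by
        refine Nat.cast_le.2 (card_le_card fun e he => ?_)
        rw [mem_filter, mem_inter] at he
        exact mem_inter.2 ⟨he.2, he.1.2⟩

/-- The bound on the number of light cuts of a graph, in terms of cuts of an induced subgraph. -/
theorem sum_exp_neg_cutWeight_le {V : Type} (w : Sym2 V → ℝ) (hw : ∀ e, 0 ≤ w e) (U : Finset V)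
    (hU : U.Nonempty) {c : ℝ} (hc : ∀ S : Finset V, S.Nonempty → S ⊂ U → c ≤ cutWeight w U S)
    {t : ℝ} (ht : 0 ≤ t) :
    ∑ S ∈ U.ssubsets.erase ∅, Real.exp (-(t * cutWeight w U S)) ≤
      (1 + Real.exp (-(c / 2 * t))) ^ U.card - 1 := by
  set p : {v // v ∈ U} × {v // v ∈ U} → {v // v ∈ U} := Prod.fst with hp
  set q : {v // v ∈ U} × {v // v ∈ U} → {v // v ∈ U} := Prod.snd with hq
  -- Edges are taken as ordered pairs, so each unordered one occurs twice and gets half its weight;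
  -- diagonal pairs are loops.
  set w' : {v // v ∈ U} × {v // v ∈ U} → ℝ := fun x => w s(x.1.1, x.2.1) / 2 with hw'
  have hcut : ∀ S : Finset {v // v ∈ U},
      multiCut w' p q S = cutWeight w U (S.map (Function.Embedding.subtype _)) := by
    intro S
    have h0 : U \ S.map (Function.Embedding.subtype _) =
        (univ \ S).map (Function.Embedding.subtype _) := by
      ext v
      simp only [Finset.mem_sdiff, Finset.mem_map, mem_univ, true_and, Function.Embedding.subtype_apply,
        Subtype.exists, exists_and_right, exists_eq_right, not_exists]
      constructor
      · rintro ⟨h1, h2⟩; exact ⟨h1, h2 h1⟩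
      · rintro ⟨h1, h2⟩; exact ⟨h1, fun _ => h2⟩
    rw [multiCut, cutWeight, h0, sum_map]
    simp only [sum_map, Function.Embedding.subtype_apply]
    have h1 : ∀ x : {v // v ∈ U} × {v // v ∈ U},
        (if (p x ∈ S ↔ q x ∈ S) then 0 else w' x) =
          (if x ∈ S ×ˢ (univ \ S) then w' x else 0) +
          (if x ∈ (univ \ S) ×ˢ S then w' x else 0) := by
      intro x
      simp only [hp, hq, mem_product, Finset.mem_sdiff, mem_univ, true_and]
      by_cases h1 : x.1 ∈ S <;> by_cases h2 : x.2 ∈ S <;> simp [h1, h2]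
    simp_rw [h1]
    rw [sum_add_distrib, sum_ite_mem, sum_ite_mem, univ_inter, univ_inter, sum_product,
      sum_product_right, ← sum_add_distrib]
    refine sum_congr rfl fun u _ => ?_
    rw [← sum_add_distrib]
    refine sum_congr rfl fun v _ => ?_
    simp only [hw']
    rw [Sym2.eq_swap (a := v.1)]
    ring
  have hsub : ∀ S ∈ properSets {v // v ∈ U}, (S.map (Function.Embedding.subtype _)).Nonempty ∧
      S.map (Function.Embedding.subtype _) ⊂ U := by
    intro S hS
    obtain ⟨h1, h2⟩ := mem_properSets.1 hS
    refine ⟨h1.map, Finset.ssubset_iff_subset_ne.2 ⟨?_, fun h => h2 ?_⟩⟩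
    · intro v hv
      rw [Finset.mem_map] at hv
      obtain ⟨x, -, rfl⟩ := hv
      exact x.2
    · ext x
      have : x.1 ∈ S.map (Function.Embedding.subtype _) := by rw [h]; exact x.2
      rw [Finset.mem_map] at this
      obtain ⟨y, hy, hyx⟩ := this
      have : y = x := Subtype.ext hyx
      simp [← this, hy]
  have hcard : Fintype.card {v // v ∈ U} = (U.card - 1) + 1 := by
    rw [Fintype.card_coe]
    have := hU.card_pos
    omega
  have main := sum_exp_neg_multiCut_le w' (fun x => div_nonneg (hw _) zero_le_two) c (U.card - 1)
    hcard p q (fun S hS => by rw [hcut]; exact hc _ (hsub S hS).1 (hsub S hS).2) t ht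
  rw [Nat.sub_add_cancel hU.card_pos] at main
  refine le_trans (le_of_eq ?_) main
  symm
  refine sum_bij (fun S _ => S.map (Function.Embedding.subtype _)) ?_ ?_ ?_ ?_
  · intro S hS
    rw [mem_erase, mem_ssubsets]
    exact ⟨(hsub S hS).1.ne_empty, (hsub S hS).2⟩
  · intro S _ S' _ h
    exact map_injective _ h
  · intro S hS
    rw [mem_erase, mem_ssubsets] at hS
    have hmap : (S.subtype (fun v => v ∈ U)).map (Function.Embedding.subtype _) = S :=
      subtype_map_of_mem fun x hx => hS.2.1 hx
    refine ⟨S.subtype (fun v => v ∈ U), ?_, hmap⟩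
    rw [mem_properSets]
    constructor
    · rw [nonempty_iff_ne_empty]
      intro h
      rw [h, map_empty] at hmap
      exact hS.1 hmap.symm
    · intro h
      rw [h] at hmap
      refine hS.2.2 fun v hv => ?_
      rw [← hmap, Finset.mem_map]
      exact ⟨⟨v, hv⟩, mem_univ _, rfl⟩
  · intro S _
    rw [hcut]

theorem card_pairs [Fintype V] : (pairs V).card = (Fintype.card V).choose 2 := by
  rw [← Sym2.card_subtype_not_diag, Fintype.card_subtype]
  unfold pairs
  congr

theorem card_pairs_le [Fintype V] : ((pairs V).card : ℝ) ≤ (Fintype.card V : ℝ) ^ 2 / 2 := by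
  rw [card_pairs, Nat.cast_choose_two]
  have : (0 : ℝ) ≤ Fintype.card V := Nat.cast_nonneg _
  nlinarith

theorem card_noise_le [Fintype V] {k : ℕ} {cl : V → Fin k} {d : Sym2 (Fin k) → ℕ}
    {E : Finset (Sym2 V)} (hE : E ∈ noiseSets cl d) {D : ℝ} (hD0 : 0 ≤ D)
    (hD : ∀ i j : Fin k, i ≠ j → (d s(i, j) : ℝ) ≤ D) : (E.card : ℝ) ≤ k ^ 2 * D := by
  rw [mem_noiseSets] at hE
  have h1 : E ⊆ (univ : Finset (Fin k × Fin k)).biUnion fun p =>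
      if p.1 = p.2 then ∅ else E.filter fun e => e.map cl = s(p.1, p.2) := by
    intro e he
    obtain ⟨i, j, hij⟩ : ∃ i j, e.map cl = s(i, j) := by
      induction e.map cl with
      | _ i j => exact ⟨i, j, rfl⟩
    have hne : i ≠ j := by
      rintro rfl
      exact hE.1 e he (by rw [hij]; rfl)
    rw [mem_biUnion]
    exact ⟨(i, j), mem_univ _, by simp [hne, he, hij]⟩
  have h2 : (E.card : ℝ) ≤ ∑ p : Fin k × Fin k,
      ((if p.1 = p.2 then ∅ else E.filter fun e => e.map cl = s(p.1, p.2)).card : ℝ) := by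
    exact_mod_cast (card_le_card h1).trans card_biUnion_le
  refine h2.trans ?_
  calc _ ≤ ∑ _p : Fin k × Fin k, D := by
        refine sum_le_sum fun p _ => ?_
        split_ifs with h
        · simpa using hD0
        · rw [hE.2 _ _ h]
          exact hD _ _ h
    _ = _ := by simp [sq]

end Cuts

/-! ### Joint law of noise edges and samples -/

section Failure

open scoped Classical

variable {V : Type} [Fintype V] {k : ℕ}

/-- The expectation of `f E s` over the noise set `E` and the sampled set `s`. -/
noncomputable def jointEv (cl : V → Fin k) (win : Sym2 V → ℝ) (d : Sym2 (Fin k) → ℕ)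
    (A : AdaptiveScheme V) (m : ℕ) (f : Finset (Sym2 V) → Finset (Sym2 V) → ℝ) : ℝ :=
  ((noiseSets cl d).card : ℝ)⁻¹ *
    ∑ E ∈ noiseSets cl d, ev (sampleLaw A (graphWeight cl win E) m) (f E)

variable (cl : V → Fin k) (win : Sym2 V → ℝ) (d : Sym2 (Fin k) → ℕ)
  (A : AdaptiveScheme V) (m : ℕ)

theorem toOuterMeasure_sampledGraphLaw (hd : (noiseSets cl d).Nonempty) (t : Set (Sym2 V → ℝ)) :
    ((sampledGraphLaw cl win d hd A m).toOuterMeasure t).toReal =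
      jointEv cl win d A m fun E s => if observed (graphWeight cl win E) s ∈ t then 1 else 0 := by
  rw [sampledGraphLaw, PMF.toOuterMeasure_bind_apply, tsum_fintype, ENNReal.toReal_sum]
  · rw [jointEv, ← ev_uniformOfFinset _ hd, ev]
    refine sum_congr rfl fun E _ => ?_
    rw [ENNReal.toReal_mul, PMF.toOuterMeasure_map_apply, toOuterMeasure_toReal]
    rfl
  · intro E _
    refine ENNReal.mul_ne_top (PMF.apply_ne_top _ _) ?_
    rw [PMF.toOuterMeasure_map_apply]
    exact ((PMF.toOuterMeasure_mono _ (Set.subset_univ _)).trans_eq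
      ((PMF.toOuterMeasure_apply_eq_one_iff _ _).2 (Set.subset_univ _))).trans_lt
        ENNReal.one_lt_top |>.ne

variable {cl win d A m}

theorem jointEv_mono {f g : Finset (Sym2 V) → Finset (Sym2 V) → ℝ}
    (h : ∀ E ∈ noiseSets cl d, ∀ s, f E s ≤ g E s) :
    jointEv cl win d A m f ≤ jointEv cl win d A m g :=
  mul_le_mul_of_nonneg_left (sum_le_sum fun E hE => ev_mono _ (h E hE)) (by positivity)

theorem jointEv_add (f g : Finset (Sym2 V) → Finset (Sym2 V) → ℝ) :
    jointEv cl win d A m (fun E s => f E s + g E s) =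
      jointEv cl win d A m f + jointEv cl win d A m g := by
  simp only [jointEv, ev_add, sum_add_distrib, mul_add]

theorem jointEv_const_mul (c : ℝ) (f : Finset (Sym2 V) → Finset (Sym2 V) → ℝ) :
    jointEv cl win d A m (fun E s => c * f E s) = c * jointEv cl win d A m f := by
  simp only [jointEv, ev_const_mul, ← mul_sum]
  ring

theorem jointEv_le_of_forall (hd : (noiseSets cl d).Nonempty)
    {f : Finset (Sym2 V) → Finset (Sym2 V) → ℝ} {c : ℝ}
    (h : ∀ E ∈ noiseSets cl d, ev (sampleLaw A (graphWeight cl win E) m) (f E) ≤ c) :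
    jointEv cl win d A m f ≤ c := by
  have h0 : (0 : ℝ) < (noiseSets cl d).card := by exact_mod_cast hd.card_pos
  rw [jointEv, inv_mul_le_iff₀ h0, ← nsmul_eq_mul]
  exact sum_le_card_nsmul _ _ _ h

end Failure

/-! ### Bounds on the failure probability -/

section Failure

open scoped Classical

variable {V : Type} [Fintype V] {k : ℕ} {cl : V → Fin k} {win : Sym2 V → ℝ}
  {d : Sym2 (Fin k) → ℕ} {A : AdaptiveScheme V} {m : ℕ}

theorem exists_inner_lt_of_lt {E s : Finset (Sym2 V)}
    (h : minInnerCut (observed (graphWeight cl win E) s) cl <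
      maxOuterCut (observed (graphWeight cl win E) s) cl) :
    ∃ (i : Fin k) (S : Finset V), S.Nonempty ∧ S ⊂ cluster cl i ∧
      cutWeight (observed (graphWeight cl win E) s) (cluster cl i) S < (E ∩ s).card := by
  have h1 : maxOuterCut (observed (graphWeight cl win E) s) cl ≤
      (((E ∩ s).card : ℝ) : EReal) :=
    iSup_le fun I => iSup_le fun _ => iSup_le fun _ =>
      EReal.coe_le_coe_iff.2 (cutWeight_outer_le cl win E s I)
  have h2 := h.trans_le h1
  simp only [minInnerCut, iInf_lt_iff, EReal.coe_lt_coe_iff] at h2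
  obtain ⟨i, S, hS, hS', h3⟩ := h2
  exact ⟨i, S, hS, hS', h3⟩

theorem sum_graphWeight_cutEdges (E : Finset (Sym2 V)) {i : Fin k} {S : Finset V}
    (hS : S ⊆ cluster cl i) :
    ∑ e ∈ cutEdges (cluster cl i) S, graphWeight cl win E e =
      cutWeight win (cluster cl i) S := by
  rw [cutWeight_eq_sum]
  exact sum_congr rfl fun e he => graphWeight_of_mem_cutEdges cl win E hS he

/-- The probability that some cut inside a cluster has small sampled weight. -/
theorem ev_exists_inner_lt_le (hV : 2 ≤ Fintype.card V)
    (hwin : ∀ e, win e ∈ Set.Icc (0 : ℝ) 1) (hne : ∀ i, (cluster cl i).Nonempty) {c : ℝ}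
    (hc0 : 0 ≤ c)
    (hc : ∀ i S, S.Nonempty → S ⊂ cluster cl i → c ≤ cutWeight win (cluster cl i) S) {x : ℝ}
    (hx : x ≤ c / 2) (E : Finset (Sym2 V)) :
    ev (sampleLaw A (graphWeight cl win E) m) (fun s =>
      if ∃ (i : Fin k) (S : Finset V), S.Nonempty ∧ S ⊂ cluster cl i ∧
        cutWeight (observed (graphWeight cl win E) s) (cluster cl i) S < x then 1 else 0) ≤
      Real.exp x * (k * ((1 + Real.exp (-(c * m / (8 * (Fintype.card V : ℝ) ^ 2)))) ^
        Fintype.card V - 1)) := by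
  have hN : (0 : ℝ) < (pairs V).card := by
    rw [card_pairs]
    exact_mod_cast Nat.choose_pos hV
  set t : ℝ := m / (8 * (pairs V).card) with ht
  have ht0 : 0 ≤ t := by positivity
  -- Union bound over all inner cuts, then the lower tail of each, then the cut-counting bound with
  -- `t = m / (8N)`.
  calc _ ≤ ev (sampleLaw A (graphWeight cl win E) m) (fun s =>
        ∑ i : Fin k, ∑ S ∈ (cluster cl i).ssubsets.erase ∅,
          if ∑ e ∈ cutEdges (cluster cl i) S ∩ s, graphWeight cl win E e < x then 1 else 0) := by
        refine ev_mono _ fun s => ?_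
        have hnn : ∀ i S, (0 : ℝ) ≤ if ∑ e ∈ cutEdges (cluster cl i) S ∩ s,
            graphWeight cl win E e < x then 1 else 0 := fun i S => by split_ifs <;> simp
        split_ifs with h
        · obtain ⟨i, S, hS, hS', hlt⟩ := h
          rw [cutWeight_observed] at hlt
          refine le_trans ?_ (single_le_sum (f := fun i =>
            ∑ S ∈ (cluster cl i).ssubsets.erase ∅,
              if ∑ e ∈ cutEdges (cluster cl i) S ∩ s, graphWeight cl win E e < x
              then (1 : ℝ) else 0) (fun i _ => sum_nonneg fun S _ => hnn i S) (mem_univ i))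
          refine le_trans ?_ (single_le_sum (fun S _ => hnn i S)
            (mem_erase.2 ⟨hS.ne_empty, mem_ssubsets.2 hS'⟩))
          rw [if_pos hlt]
        · exact sum_nonneg fun i _ => sum_nonneg fun S _ => hnn i S
    _ = ∑ i : Fin k, ∑ S ∈ (cluster cl i).ssubsets.erase ∅,
          ev (sampleLaw A (graphWeight cl win E) m) (fun s =>
          if ∑ e ∈ cutEdges (cluster cl i) S ∩ s, graphWeight cl win E e < x
          then 1 else 0) := by
        rw [ev_sum]
        exact sum_congr rfl fun i _ => ev_sum _ _ _
    _ ≤ ∑ i : Fin k, ∑ S ∈ (cluster cl i).ssubsets.erase ∅,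
          Real.exp x * Real.exp (-(t * cutWeight win (cluster cl i) S)) := by
        refine sum_le_sum fun i _ => sum_le_sum fun S hS => ?_
        rw [mem_erase, mem_ssubsets] at hS
        have hS1 := nonempty_iff_ne_empty.2 hS.1
        have h1 := ev_sampleLaw_lt_le A (graphWeight cl win E) (cutEdges (cluster cl i) S)
          (cutEdges_subset_pairs _ _) (fun e he => by
            rw [graphWeight_of_mem_cutEdges cl win E hS.2.1 he]; exact hwin e) m (x := x) (by
            rw [sum_graphWeight_cutEdges E hS.2.1]
            linarith [hc i S hS1 hS.2])
        rw [sum_graphWeight_cutEdges E hS.2.1] at h1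
        refine h1.trans (le_of_eq ?_)
        rw [ht]
        congr 3
        ring
    _ ≤ ∑ _i : Fin k, Real.exp x * ((1 + Real.exp (-(c * m / (8 * (Fintype.card V : ℝ) ^ 2)))) ^
        Fintype.card V - 1) := by
        refine sum_le_sum fun i _ => ?_
        rw [← mul_sum]
        refine mul_le_mul_of_nonneg_left ?_ (Real.exp_nonneg _)
        refine (sum_exp_neg_cutWeight_le win (fun e => (hwin e).1) _ (hne i)
          (fun S => hc i S) ht0).trans (sub_le_sub_right ?_ 1)
        -- Uses N ≤ n²/2.
        have h1 : c * m / (8 * (Fintype.card V : ℝ) ^ 2) ≤ c / 2 * t := by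
          rw [ht, div_mul_div_comm]
          refine div_le_div_of_nonneg_left (by positivity) (by positivity) ?_
          have := card_pairs_le (V := V)
          linarith
        refine le_trans (pow_le_pow_right₀ (by linarith [Real.exp_nonneg (-(c / 2 * t))])
          (card_le_univ _)) (pow_le_pow_left₀ (by positivity) ?_ _)
        linarith [Real.exp_le_exp.2 (neg_le_neg h1)]
    _ = _ := by
        simp
        ring

theorem inner_cut_nonneg (hwin : ∀ e, win e ∈ Set.Icc (0 : ℝ) 1) (E s : Finset (Sym2 V))
    {i : Fin k} {S : Finset V} (hS : S ⊆ cluster cl i) :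
    0 ≤ cutWeight (observed (graphWeight cl win E) s) (cluster cl i) S := by
  rw [cutWeight_observed]
  refine sum_nonneg fun e he => ?_
  rw [graphWeight_of_mem_cutEdges cl win E hS (mem_inter.1 he).1]
  exact (hwin e).1

/-- The clusters are only misjudged if a noise edge is sampled. -/
theorem failure_le_one_sub (hd : (noiseSets cl d).Nonempty)
    (hwin : ∀ e, win e ∈ Set.Icc (0 : ℝ) 1) {B D : ℝ} (hB : 0 < B) (hD0 : 0 ≤ D)
    (hDB : 2 * D / B ≤ 1) (hD : ∀ i j : Fin k, i ≠ j → (d s(i, j) : ℝ) ≤ D)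
    (hcard : ∀ i j : Fin k, i ≠ j → B ≤ ((cluster cl i).card : ℝ) * (cluster cl j).card)
    (hm : (m : ℝ) ≤ B / 2) :
    ((sampledGraphLaw cl win d hd A m).toOuterMeasure
      {w | minInnerCut w cl < maxOuterCut w cl}).toReal ≤ 1 - (1 - 2 * D / B) ^ m := by
  have hN : (0 : ℝ) < (noiseSets cl d).card := by exact_mod_cast hd.card_pos
  rw [toOuterMeasure_sampledGraphLaw]
  have h1 := noiseGen_zero_ge cl win d A hB hD0 hDB hD
    (fun i j hij => (hcard i j hij).trans (by exact_mod_cast card_block_ge cl hij)) m hm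
  -- Failure and sampling no noise are disjoint events, since inner cuts have nonnegative sampled
  -- weight.
  have h2 : jointEv cl win d A m (fun E s =>
      (if observed (graphWeight cl win E) s ∈ {w | minInnerCut w cl < maxOuterCut w cl}
        then 1 else 0) + (0 : ℝ) ^ (E ∩ s).card) ≤ 1 := by
    refine jointEv_le_of_forall hd fun E _ => le_of_le_of_eq (ev_mono _ fun s => ?_)
      (ev_const _ 1)
    by_cases h : observed (graphWeight cl win E) s ∈ {w | minInnerCut w cl < maxOuterCut w cl}
    · obtain ⟨i, S, -, hS, hlt⟩ := exists_inner_lt_of_lt h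
      have h3 := (inner_cut_nonneg hwin E s hS.1).trans_lt hlt
      have h4 : (E ∩ s).card ≠ 0 := by
        rintro h0
        rw [h0] at h3
        simp at h3
      rw [if_pos h, zero_pow h4, add_zero]
    · rw [if_neg h, zero_add]
      exact pow_le_one₀ le_rfl zero_le_one
  rw [jointEv_add] at h2
  have h3 : (1 - 2 * D / B) ^ m ≤ jointEv cl win d A m fun E s => (0 : ℝ) ^ (E ∩ s).card := by
    rw [jointEv, le_inv_mul_iff₀ hN, mul_comm]
    exact h1
  refine le_of_eq_of_le ?_ ((le_sub_iff_add_le.2 h2).trans (sub_le_sub_left h3 1))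
  congr!

/-- The failure probability, in terms of a threshold that separates the inner and outer cuts. -/
theorem failure_le_threshold (hd : (noiseSets cl d).Nonempty) (hV : 2 ≤ Fintype.card V)
    (hwin : ∀ e, win e ∈ Set.Icc (0 : ℝ) 1) (hne : ∀ i, (cluster cl i).Nonempty) {c : ℝ}
    (hc0 : 0 ≤ c)
    (hc : ∀ i S, S.Nonempty → S ⊂ cluster cl i → c ≤ cutWeight win (cluster cl i) S) {x : ℝ}
    (hx : x ≤ c / 2) :
    ((sampledGraphLaw cl win d hd A m).toOuterMeasure
      {w | minInnerCut w cl < maxOuterCut w cl}).toReal ≤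
      Real.exp x * (k * ((1 + Real.exp (-(c * m / (8 * (Fintype.card V : ℝ) ^ 2)))) ^
        Fintype.card V - 1)) +
      jointEv cl win d A m fun E s => if x < (E ∩ s).card then 1 else 0 := by
  rw [toOuterMeasure_sampledGraphLaw]
  refine le_trans (jointEv_mono fun E _ s => ?_) ((jointEv_add (fun E s =>
    if ∃ (i : Fin k) (S : Finset V), S.Nonempty ∧ S ⊂ cluster cl i ∧
        cutWeight (observed (graphWeight cl win E) s) (cluster cl i) S < x then 1 else 0)
    fun E s => if x < (E ∩ s).card then 1 else 0).trans_le (add_le_add_left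
      (jointEv_le_of_forall hd fun E _ =>
        ev_exists_inner_lt_le hV hwin hne hc0 hc hx E) _))
  -- On failure, either more than `x` noise edges were sampled or some inner cut is below `x`.
  by_cases h : observed (graphWeight cl win E) s ∈ {w | minInnerCut w cl < maxOuterCut w cl}
  · obtain ⟨i, S, hS, hS', hlt⟩ := exists_inner_lt_of_lt h
    rw [if_pos h]
    by_cases h1 : x < (E ∩ s).card
    · rw [if_pos h1]
      split_ifs <;> simp
    · rw [if_pos ⟨i, S, hS, hS', hlt.trans_le (not_lt.1 h1)⟩, if_neg h1, add_zero]
  · rw [if_neg h]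
    split_ifs <;> simp

theorem jointEv_noise_eq_zero {D x : ℝ} (hD0 : 0 ≤ D)
    (hD : ∀ i j : Fin k, i ≠ j → (d s(i, j) : ℝ) ≤ D) (hx : k ^ 2 * D ≤ x) :
    jointEv cl win d A m (fun E s => if x < (E ∩ s).card then 1 else 0) = 0 := by
  rw [jointEv, sum_eq_zero, mul_zero]
  intro E hE
  refine (ev_congr_of_support _ fun s _ => ?_).trans (ev_const _ 0)
  rw [if_neg]
  have h1 := card_noise_le hE hD0 hD
  have h2 : ((E ∩ s).card : ℝ) ≤ E.card := by exact_mod_cast card_le_card inter_subset_left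
  linarith

/-- Chernoff bound with base `exp 1`; the estimate `exp 1 - 1 ≤ 2` turns the rate 2D/B into 4D/B. -/
theorem jointEv_noise_le (hd : (noiseSets cl d).Nonempty) {B D : ℝ} (hB : 0 < B) (hD0 : 0 ≤ D)
    (hD : ∀ i j : Fin k, i ≠ j → (d s(i, j) : ℝ) ≤ D)
    (hcard : ∀ i j : Fin k, i ≠ j → B ≤ ((cluster cl i).card : ℝ) * (cluster cl j).card)
    (hm : (m : ℝ) ≤ B / 2) (x : ℝ) :
    jointEv cl win d A m (fun E s => if x < (E ∩ s).card then 1 else 0) ≤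
      Real.exp (-x) * Real.exp (m * (4 * D / B)) := by
  have hN : (0 : ℝ) < (noiseSets cl d).card := by exact_mod_cast hd.card_pos
  have h1 := noiseGen_le cl win d A (Real.one_le_exp zero_le_one) hB hD0 hD
    (fun i j hij => (hcard i j hij).trans (by exact_mod_cast card_block_ge cl hij)) m hm
  have he : Real.exp 1 - 1 ≤ 2 := by linarith [Real.exp_one_lt_d9]
  have he0 : 0 ≤ Real.exp 1 - 1 := by linarith [Real.one_le_exp zero_le_one]
  have hp : 0 ≤ 2 * D / B := by positivity
  have h2 : (1 + (Real.exp 1 - 1) * (2 * D / B)) ^ m ≤ Real.exp (m * (4 * D / B)) := by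
    rw [Real.exp_nat_mul]
    refine pow_le_pow_left₀ (by positivity) ?_ m
    have h3 := Real.add_one_le_exp (4 * D / B)
    have h4 := mul_le_mul_of_nonneg_right he hp
    have h5 : 2 * (2 * D / B) = 4 * D / B := by ring
    linarith
  calc _ ≤ jointEv cl win d A m (fun E s => Real.exp (-x) * Real.exp 1 ^ (E ∩ s).card) := by
        refine jointEv_mono fun E _ s => ?_
        split_ifs with h
        · rw [← Real.exp_nat_mul, ← Real.exp_add]
          exact Real.one_le_exp (by linarith)
        · positivity
    _ ≤ _ := by
        rw [jointEv_const_mul]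
        refine mul_le_mul_of_nonneg_left ?_ (Real.exp_nonneg _)
        rw [jointEv, inv_mul_le_iff₀ hN, mul_comm]
        exact h1.trans (mul_le_mul_of_nonneg_right h2 hN.le)

end Failure

/-! ### Elementary inequalities -/

section Numerics

theorem exp_neg_two_mul_le {p : ℝ} (h0 : 0 ≤ p) (h1 : p ≤ 1 / 2) : Real.exp (-(2 * p)) ≤ 1 - p := by
  have h2 := Real.add_one_le_exp (2 * p)
  rw [Real.exp_neg, inv_le_comm₀ (Real.exp_pos _) (by linarith)]
  refine le_trans ?_ h2
  rw [inv_le_iff_one_le_mul₀ (by linarith)]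
  nlinarith

theorem one_add_pow_sub_one_le {y : ℝ} (hy : 0 ≤ y) (n : ℕ) (h : n * y ≤ 1) :
    (1 + y) ^ n - 1 ≤ 2 * (n * y) := by
  have h1 : (1 + y) ^ n ≤ Real.exp (n * y) := by
    rw [Real.exp_nat_mul]
    exact pow_le_pow_left₀ (by linarith) (by linarith [Real.add_one_le_exp y]) n
  have h0 : 0 ≤ n * y := by positivity
  have h2 := Real.abs_exp_sub_one_le (x := n * y) (by rwa [abs_of_nonneg h0])
  rw [abs_of_nonneg h0] at h2
  linarith [le_abs_self (Real.exp (n * y) - 1)]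

/-- Since n ≤ exp(M/4), the union over `k` clusters and `n` vertices costs at most exp(M/2), and the
threshold another exp(M/4); of exp(-M) there remains exp(-M/4). -/
theorem exp_mul_union_le {M x : ℝ} {n k : ℕ} (hn : 1 ≤ n) (hk : k ≤ n)
    (hM : 4 * Real.log n ≤ M) (hx : x ≤ M / 4) :
    Real.exp x * (k * ((1 + Real.exp (-M)) ^ n - 1)) ≤ 2 * Real.exp (-(M / 4)) := by
  have hn0 : (0 : ℝ) < n := by exact_mod_cast hn
  have hlog : 0 ≤ Real.log n := Real.log_nonneg (by exact_mod_cast hn)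
  have h1 : (n : ℝ) ≤ Real.exp (M / 4) := by
    rw [← Real.log_le_iff_le_exp hn0]
    linarith
  have h2 : (n : ℝ) * n ≤ Real.exp (M / 2) := by
    have := mul_le_mul h1 h1 hn0.le (Real.exp_nonneg _)
    rwa [← Real.exp_add, show M / 4 + M / 4 = M / 2 by ring] at this
  have hsplit : Real.exp (M / 2) * Real.exp (-M) = Real.exp (-(M / 2)) := by
    rw [← Real.exp_add]; congr 1; ring
  have h3 : (n : ℝ) * Real.exp (-M) ≤ 1 := by
    calc _ ≤ Real.exp (M / 4) * Real.exp (-M) :=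
          mul_le_mul_of_nonneg_right h1 (Real.exp_nonneg _)
      _ = Real.exp (M / 4 + -M) := (Real.exp_add _ _).symm
      _ ≤ 1 := Real.exp_le_one_iff.2 (by linarith)
  have h4 := one_add_pow_sub_one_le (Real.exp_nonneg (-M)) n h3
  have h5 : (k : ℝ) * ((1 + Real.exp (-M)) ^ n - 1) ≤ 2 * Real.exp (-(M / 2)) := by
    calc _ ≤ (n : ℝ) * (2 * (n * Real.exp (-M))) :=
          mul_le_mul (by exact_mod_cast hk) h4
            (sub_nonneg.2 (one_le_pow₀ (by linarith [Real.exp_nonneg (-M)]))) hn0.le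
      _ = 2 * (n * n * Real.exp (-M)) := by ring
      _ ≤ 2 * (Real.exp (M / 2) * Real.exp (-M)) := by gcongr
      _ = _ := by rw [hsplit]
  calc _ ≤ Real.exp (M / 4) * (2 * Real.exp (-(M / 2))) :=
        mul_le_mul (Real.exp_le_exp.2 hx) h5 (mul_nonneg (Nat.cast_nonneg _)
          (sub_nonneg.2 (one_le_pow₀ (by linarith [Real.exp_nonneg (-M)])))) (Real.exp_nonneg _)
    _ = 2 * (Real.exp (M / 4) * Real.exp (-(M / 2))) := by ring
    _ = _ := by rw [← Real.exp_add]; congr 2; ring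

end Numerics

/-! ### The regimes of many and of few samples -/

section Main

open scoped Classical

variable {V : Type} [Fintype V] {k : ℕ} {cl : V → Fin k} {win : Sym2 V → ℝ}
  {d : Sym2 (Fin k) → ℕ} {A : AdaptiveScheme V} {m : ℕ}

theorem sum_card_cluster (cl : V → Fin k) :
    ∑ i, (cluster cl i).card = Fintype.card V :=
  (card_eq_sum_card_fiberwise (f := cl) (s := univ) (t := univ) (by simp)).symm

theorem mul_le_card_of_le_cluster {y : ℝ} (h : ∀ i, y ≤ ((cluster cl i).card : ℝ)) :
    k * y ≤ Fintype.card V := by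
  rw [← sum_card_cluster cl]
  push_cast
  simpa using card_nsmul_le_sum univ (fun i => ((cluster cl i).card : ℝ)) y fun i _ => h i

theorem failure_of_no_noise (hd : (noiseSets cl d).Nonempty)
    (hwin : ∀ e, win e ∈ Set.Icc (0 : ℝ) 1) (hD : ∀ i j : Fin k, i ≠ j → d s(i, j) = 0) :
    ((sampledGraphLaw cl win d hd A m).toOuterMeasure
      {w | minInnerCut w cl < maxOuterCut w cl}).toReal ≤ 0 := by
  rw [toOuterMeasure_sampledGraphLaw]
  refine jointEv_le_of_forall hd fun E hE => le_of_le_of_eq (ev_mono _ fun s => ?_) (ev_const _ 0)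
  have h0 := card_noise_le hE le_rfl fun i j hij => by rw [hD i j hij]; simp
  rw [mul_zero] at h0
  have h1 : ((E ∩ s).card : ℝ) ≤ E.card := by exact_mod_cast card_le_card inter_subset_left
  rw [if_neg]
  intro h
  obtain ⟨i, S, -, hS, hlt⟩ := exists_inner_lt_of_lt h
  linarith [inner_cut_nonneg hwin E s hS.1]

theorem le_cutWeight_of_le_minInnerCut {c : ℝ} (h : (c : EReal) ≤ minInnerCut win cl) (i : Fin k)
    (S : Finset V) (hS : S.Nonempty) (hS' : S ⊂ cluster cl i) :
    c ≤ cutWeight win (cluster cl i) S := by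
  simp only [minInnerCut, le_iInf_iff] at h
  exact EReal.coe_le_coe_iff.1 (h i S hS hS')

/-- The failure probability when there are enough samples to connect all clusters. -/
theorem failure_le_of_many_samples (hd : (noiseSets cl d).Nonempty) {n : ℕ}
    (hV : Fintype.card V = n) (hn : 2 ≤ n) (hwin : ∀ e, win e ∈ Set.Icc (0 : ℝ) 1)
    {a b η ν : ℝ} (ha : 0 < a) (hb : 0 < b) (hη : 0 ≤ η) (hν : 0 < ν)
    (hcl : ∀ i, a * n ≤ ((cluster cl i).card : ℝ))
    (hcut : ((b * ν : ℝ) : EReal) ≤ minInnerCut win cl)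
    (hD : ∀ i j : Fin k, i ≠ j → (d s(i, j) : ℝ) ≤ η * ν)
    (hη1 : 4 * η ≤ a ^ 2 * b) (hη2 : 64 * η ≤ a ^ 4 * b) (hη3 : 256 * η ≤ a ^ 2 * b)
    (hM : 4 * Real.log n ≤ b * ν * m / (8 * (n : ℝ) ^ 2)) :
    ((sampledGraphLaw cl win d hd A m).toOuterMeasure
      {w | minInnerCut w cl < maxOuterCut w cl}).toReal ≤
      3 * Real.exp (-(b * ν * m / (8 * (n : ℝ) ^ 2) / 8)) := by
  set M := b * ν * m / (8 * (n : ℝ) ^ 2) with hMdef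
  have hn0 : (0 : ℝ) < n := by exact_mod_cast (by omega : 0 < n)
  have hM0 : 0 ≤ M := by positivity
  have hone : ∀ i, (1 : ℝ) ≤ ((cluster cl i).card : ℝ) := by
    intro i
    have : (0 : ℝ) < ((cluster cl i).card : ℝ) := (mul_pos ha hn0).trans_le (hcl i)
    exact_mod_cast Nat.cast_pos.1 this
  have hne : ∀ i, (cluster cl i).Nonempty := fun i => card_pos.1 (by exact_mod_cast hone i)
  have hkn : k ≤ n := by
    have := mul_le_card_of_le_cluster hone
    rw [hV, mul_one] at this
    exact_mod_cast this
  have hka : k * a ≤ 1 := by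
    have := mul_le_card_of_le_cluster hcl
    rw [hV, ← mul_assoc] at this
    exact le_of_mul_le_mul_right (by linarith) hn0
  have hcut' := le_cutWeight_of_le_minInnerCut hcut
  -- The threshold is `min M (b ν) / 4`: below `M / 4` to survive the union bound, below half the
  -- minimal cut for the lower tail to apply.
  have hx1 : min M (b * ν) / 4 ≤ M / 4 := by linarith [min_le_left M (b * ν)]
  have hx2 : min M (b * ν) / 4 ≤ b * ν / 2 := by
    have := min_le_right M (b * ν)
    have : 0 < b * ν := by positivity
    linarith
  have h1 := failure_le_threshold (A := A) (m := m) hd (by omega) hwin hne (by positivity) hcut' hx2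
  rw [hV] at h1
  have h2 := exp_mul_union_le (by omega) hkn hM hx1
  have h3 : Real.exp (-(M / 4)) ≤ Real.exp (-(M / 8)) := Real.exp_le_exp.2 (by linarith)
  have h4 : jointEv cl win d A m
      (fun E s => if min M (b * ν) / 4 < (E ∩ s).card then 1 else 0) ≤ Real.exp (-(M / 8)) := by
    -- Exchangeability helps only while at most half of a block's guaranteed `(a n)^2` pairs are
    -- seen. Beyond that, `M` is so large that the threshold exceeds the total number of noise
    -- edges.
    by_cases hm : (m : ℝ) ≤ (a * n) ^ 2 / 2
    · have hB : 0 < (a * n) ^ 2 := by positivity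
      have h5 := jointEv_noise_le (win := win) (A := A) hd hB (by positivity : 0 ≤ η * ν) hD
        (fun i j _ => by
          rw [sq]
          exact mul_le_mul (hcl i) (hcl j) (by positivity) (by positivity)) hm
        (min M (b * ν) / 4)
      refine h5.trans ?_
      rw [← Real.exp_add]
      refine Real.exp_le_exp.2 ?_
      -- The exponent gained by noise is at most half of the threshold `M / 4`; this is where 256
      -- comes from.
      have h6 : m * (4 * (η * ν) / (a * n) ^ 2) ≤ M / 8 := by
        rw [hMdef, div_div, mul_div_assoc', div_le_div_iff₀ (by positivity) (by positivity)]
        have := mul_le_mul_of_nonneg_right hη3 (show 0 ≤ m * ν * (n : ℝ) ^ 2 by positivity)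
        linarith
      rcases Nat.lt_or_ge k 1 with hk | hk
      · have hk0 : k = 0 := by omega
        have := sum_card_cluster cl
        subst hk0
        simp at this
        omega
      · have ha1 : a ≤ 1 := by
          have : (1 : ℝ) ≤ k := by exact_mod_cast hk
          nlinarith
        have h7 : M ≤ b * ν := by
          rw [hMdef, div_le_iff₀ (by positivity)]
          have h8 : (a * n) ^ 2 ≤ (n : ℝ) ^ 2 := by
            rw [mul_pow]
            have : a ^ 2 ≤ 1 := pow_le_one₀ ha.le ha1
            have h9 : (0 : ℝ) ≤ (n : ℝ) ^ 2 := by positivity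
            nlinarith
          have h9 : (m : ℝ) ≤ 8 * (n : ℝ) ^ 2 := by
            have : (0 : ℝ) ≤ (n : ℝ) ^ 2 := by positivity
            linarith
          gcongr
        rw [min_eq_left h7]
        linarith
    · rw [jointEv_noise_eq_zero (by positivity : 0 ≤ η * ν) hD]
      · exact Real.exp_nonneg _
      · have h5 : (k : ℝ) ^ 2 * a ^ 2 ≤ 1 := by
          rw [← mul_pow]
          exact pow_le_one₀ (by positivity) hka
        have ha2 : 0 < a ^ 2 := by positivity
        have h6 : (k : ℝ) ^ 2 * η * 4 ≤ b := by
          have h7 := mul_le_mul_of_nonneg_left hη1 (sq_nonneg (k : ℝ))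
          have h8 := mul_le_mul_of_nonneg_right h5 hb.le
          nlinarith
        have h6' : (k : ℝ) ^ 2 * η * 64 ≤ a ^ 2 * b := by
          have h7 := mul_le_mul_of_nonneg_left hη2 (sq_nonneg (k : ℝ))
          have h8 := mul_le_mul_of_nonneg_right h5 (by positivity : 0 ≤ a ^ 2 * b)
          nlinarith
        have h7 : a ^ 2 * b * ν / 16 ≤ M := by
          rw [hMdef, le_div_iff₀ (by positivity)]
          have h8 := mul_le_mul_of_nonneg_left (not_le.1 hm).le (by positivity : 0 ≤ b * ν)
          have : a ^ 2 * b * ν / 16 * (8 * (n : ℝ) ^ 2) = b * ν * ((a * n) ^ 2 / 2) := by ring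
          linarith
        rw [le_div_iff₀ (by norm_num)]
        refine le_min ?_ ?_
        · have := mul_le_mul_of_nonneg_right h6' hν.le
          linarith
        · have := mul_le_mul_of_nonneg_right h6 hν.le
          linarith
  linarith

/-- The failure probability when there are few samples. -/
theorem failure_le_of_few_samples (hd : (noiseSets cl d).Nonempty) {n : ℕ}
    (hn : 2 ≤ n) (hwin : ∀ e, win e ∈ Set.Icc (0 : ℝ) 1)
    {a η u : ℝ} (ha : 0 < a) (hη : 0 ≤ η) (hu : 0 < u) (hu1 : u ≤ 1)
    (hcl : ∀ i, a * n ≤ ((cluster cl i).card : ℝ))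
    (hD : ∀ i j : Fin k, i ≠ j → (d s(i, j) : ℝ) ≤ η * (u * (n : ℝ) ^ 2))
    (hη1 : 4 * η ≤ a ^ 2) (hm : (m : ℝ) ≤ (a * n) ^ 2 / 2) :
    ((sampledGraphLaw cl win d hd A m).toOuterMeasure
      {w | minInnerCut w cl < maxOuterCut w cl}).toReal ≤
      1 - Real.exp (-(4 * η / a ^ 2 * (m * u))) := by
  have hn0 : (0 : ℝ) < n := by exact_mod_cast (by omega : 0 < n)
  have hB : 0 < (a * n) ^ 2 := by positivity
  have hp : 2 * (η * (u * (n : ℝ) ^ 2)) / (a * n) ^ 2 = 2 * η / a ^ 2 * u := by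
    field_simp
  have hp1 : 2 * η / a ^ 2 * u ≤ 1 / 2 := by
    have : 2 * η / a ^ 2 ≤ 1 / 2 := by
      rw [div_le_iff₀ (by positivity)]
      linarith
    have h0 : 0 ≤ 2 * η / a ^ 2 := by positivity
    nlinarith
  have h1 := failure_le_one_sub (A := A) (m := m) hd hwin hB
    (by positivity : 0 ≤ η * (u * (n : ℝ) ^ 2)) (by rw [hp]; linarith) hD
    (fun i j _ => by
      rw [sq]
      exact mul_le_mul (hcl i) (hcl j) (by positivity) (by positivity)) hm
  rw [hp] at h1
  refine h1.trans (sub_le_sub_left ?_ 1)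
  have h2 := exp_neg_two_mul_le (by positivity : 0 ≤ 2 * η / a ^ 2 * u) hp1
  refine le_trans (le_of_eq ?_) (pow_le_pow_left₀ (Real.exp_nonneg _) h2 m)
  rw [← Real.exp_nat_mul]
  congr 1
  ring

/-- The failure probability for a fixed number of vertices `n`, where `u` plays the role of
`n ^ (α - 2)` and `z` that of `n ^ ε`. -/
theorem failure_lt (hd : (noiseSets cl d).Nonempty) {n : ℕ}
    (hV : Fintype.card V = n) (hn : 82 ≤ n) (hwin : ∀ e, win e ∈ Set.Icc (0 : ℝ) 1)
    {a b η u z ε : ℝ} (ha : 0 < a) (hb : 0 < b) (hη : 0 ≤ η) (hu : 0 < u) (hz : 0 < z)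
    (hcl : ∀ i, a * n ≤ ((cluster cl i).card : ℝ))
    (hcut : ((b * (u * (n : ℝ) ^ 2) : ℝ) : EReal) ≤ minInnerCut win cl)
    (hD : ∀ i j : Fin k, i ≠ j → (d s(i, j) : ℝ) ≤ η * (u * (n : ℝ) ^ 2))
    (hη1 : 4 * η ≤ a ^ 2 * b) (hη2 : 64 * η ≤ a ^ 4 * b) (hη3 : 256 * η ≤ a ^ 2 * b)
    (hη4 : 4 * η ≤ a ^ 2) (hη5 : 4 * η / a ^ 2 * (32 / b) ≤ ε / 2)
    (hz1 : 128 / b ≤ z) (hz2 : 32 / b * Real.log n / z < Real.exp (-(ε / 2 * Real.log n)))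
    (hu1 : 32 / b * Real.log n / u ≤ (a * n) ^ 2 / 2)
    (hu2 : 32 / b * Real.log n / u < 1 ∨ u ≤ 1) (hm : 0 < m) :
    ((sampledGraphLaw cl win d hd A m).toOuterMeasure
      {w | minInnerCut w cl < maxOuterCut w cl}).toReal < Real.exp (-(m * u / z)) := by
  have hn0 : (0 : ℝ) < n := by exact_mod_cast (by omega : 0 < n)
  have hlog : 0 < Real.log n := Real.log_pos (by exact_mod_cast (by omega : 1 < n))
  have hm1 : (1 : ℝ) ≤ m := by exact_mod_cast hm
  -- The regimes meet at m u = (32/b) ln n, which is `M = 4 ln n` because `M = b m u / 8`.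
  rcases le_or_gt (m : ℝ) (32 / b * Real.log n / u) with h | h
  · have hu1' : u ≤ 1 := hu2.resolve_left fun h' => by linarith
    have h1 := failure_le_of_few_samples (A := A) hd (by omega) hwin ha hη hu hu1' hcl hD hη4
      (h.trans hu1)
    refine h1.trans_lt ?_
    have h2 : m * u ≤ 32 / b * Real.log n := (le_div_iff₀ hu).1 h
    -- Compare complements: no noise is sampled with probability at least n^(-ε/2), while 1 - exp(-m
    -- u / z) ≤ m u / z ≤ (32/b) ln n / z, which is smaller.
    have h3 : m * u / z ≤ 32 / b * Real.log n / z := div_le_div_of_nonneg_right h2 hz.le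
    have h4 : Real.exp (-(ε / 2 * Real.log n)) ≤ Real.exp (-(4 * η / a ^ 2 * (m * u))) := by
      refine Real.exp_le_exp.2 (neg_le_neg ?_)
      have h5 := mul_le_mul_of_nonneg_left h2 (by positivity : 0 ≤ 4 * η / a ^ 2)
      have h6 := mul_le_mul_of_nonneg_right hη5 hlog.le
      linarith
    have h7 := Real.one_sub_le_exp_neg (m * u / z)
    linarith
  · set M := b * (u * (n : ℝ) ^ 2) * m / (8 * (n : ℝ) ^ 2) with hMdef
    have hM : M = b * (m * u) / 8 := by
      rw [hMdef]
      field_simp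
    have h2 : 32 / b * Real.log n < m * u := (div_lt_iff₀ hu).1 h
    have h3 : 4 * Real.log n ≤ M := by
      have := mul_lt_mul_of_pos_left h2 hb
      have h4 : b * (32 / b * Real.log n) = 32 * Real.log n := by field_simp
      rw [hM]
      linarith
    have h1 := failure_le_of_many_samples (A := A) hd hV (by omega) hwin ha hb hη
      (by positivity : 0 < u * (n : ℝ) ^ 2) hcl hcut hD hη1 hη2 hη3 h3
    refine h1.trans_lt ?_
    have h5 : m * u / z ≤ M / 16 := by
      rw [hM, div_le_iff₀ hz]
      have h6 : 128 ≤ z * b := (div_le_iff₀ hb).1 hz1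
      have h7 := mul_le_mul_of_nonneg_right h6 (by positivity : 0 ≤ m * u)
      linarith
    -- The factor 3 is absorbed by exp(M/16) ≥ n^(1/4), as n ≥ 82 > 3^4.
    have h6 : Real.log 3 < Real.log n / 4 := by
      have h7 : Real.log ((3 : ℝ) ^ 4) < Real.log n :=
        Real.log_lt_log (by norm_num) (by
          have : (82 : ℝ) ≤ n := by exact_mod_cast hn
          linarith)
      rw [Real.log_pow] at h7
      push_cast at h7
      linarith
    have h7 : (3 : ℝ) = Real.exp (Real.log 3) := (Real.exp_log (by norm_num)).symm
    rw [h7, ← Real.exp_add]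
    refine Real.exp_lt_exp.2 ?_
    linarith

end Main

/-! ### Growth of logarithms, and the choice of constants -/

section Asymptotics

theorem eventually_mul_log_le_rpow (K : ℝ) {c r : ℝ} (hc : 0 < c) (hr : 0 < r) :
    ∀ᶠ n : ℕ in atTop, K * Real.log n ≤ c * (n : ℝ) ^ r := by
  have h := ((isLittleO_log_rpow_atTop hr).const_mul_left K).comp_tendsto
    tendsto_natCast_atTop_atTop
  filter_upwards [h.def hc] with n hn
  simp only [Function.comp_apply, Real.norm_eq_abs] at hn
  rw [abs_of_nonneg (a := (n : ℝ) ^ r) (by positivity)] at hn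
  exact (le_abs_self _).trans hn

/-- The exponent `q` may be negative, so `(ln n)^(-q)` is compared with `n^r`. -/
theorem eventually_one_le_mul_log_rpow {C r : ℝ} (q : ℝ) (hC : 0 < C) (hr : 0 < r) :
    ∀ᶠ n : ℕ in atTop, 1 ≤ C * (n : ℝ) ^ r * Real.log n ^ q := by
  have h := (isLittleO_log_rpow_rpow_atTop (-q) hr).comp_tendsto tendsto_natCast_atTop_atTop
  filter_upwards [h.def hC, eventually_ge_atTop 2] with n hn hn2
  have hlog : 0 < Real.log n := Real.log_pos (by exact_mod_cast hn2)
  simp only [Function.comp_apply, Real.norm_eq_abs] at hn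
  rw [abs_of_nonneg (by positivity), abs_of_nonneg (by positivity), Real.rpow_neg hlog.le,
    inv_le_iff_one_le_mul₀ (by positivity)] at hn
  exact hn

end Asymptotics

/-- The failure probability is below `δ` for a fixed number of vertices `n`. -/
theorem failure_measure_lt {V : Type} [Fintype V] [inst : DecidableEq V] {k : ℕ} {cl : V → Fin k}
    {win : Sym2 V → ℝ} {d : Sym2 (Fin k) → ℕ} {A : AdaptiveScheme V} {m : ℕ}
    (hd : (noiseSets cl d).Nonempty) {n : ℕ}
    (hV : Fintype.card V = n) (hn : 82 ≤ n) (hwin : ∀ e, win e ∈ Set.Icc (0 : ℝ) 1)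
    {a b η u z ε : ℝ} (ha : 0 < a) (hb : 0 < b) (hη : 0 ≤ η) (hu : 0 < u) (hz : 0 < z)
    (hcl : ∀ i, a * n ≤ ((cluster cl i).card : ℝ))
    (hcut : ((b * (u * (n : ℝ) ^ 2) : ℝ) : EReal) ≤ minInnerCut win cl)
    (hD : ∀ i j : Fin k, i ≠ j → (d s(i, j) : ℝ) ≤ η * (u * (n : ℝ) ^ 2))
    (hη1 : 4 * η ≤ a ^ 2 * b) (hη2 : 64 * η ≤ a ^ 4 * b) (hη3 : 256 * η ≤ a ^ 2 * b)
    (hη4 : 4 * η ≤ a ^ 2) (hη5 : 4 * η / a ^ 2 * (32 / b) ≤ ε / 2)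
    (hz1 : 128 / b ≤ z) (hz2 : 32 / b * Real.log n / z < Real.exp (-(ε / 2 * Real.log n)))
    (h : (∀ i j : Fin k, i ≠ j → d s(i, j) = 0) ∨
      (32 / b * Real.log n / u ≤ (a * n) ^ 2 / 2 ∧
        (32 / b * Real.log n / u < 1 ∨ u ≤ 1) ∧ 0 < m)) {δ : ℝ} (hδ : 0 < δ)
    (hδm : Real.exp (-(m * u / z)) ≤ δ) :
    (sampledGraphLaw cl win d hd A m).toOuterMeasure
      {w | minInnerCut w cl < maxOuterCut w cl} < ENNReal.ofReal δ := by
  classical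
  -- The earlier bounds use classical decidability of equality; any other instance is equal to it.
  obtain rfl : inst = fun a b => Classical.propDecidable (a = b) := Subsingleton.elim _ _
  have hfin : (sampledGraphLaw cl win d hd A m).toOuterMeasure
      {w | minInnerCut w cl < maxOuterCut w cl} ≠ ∞ :=
    (((PMF.toOuterMeasure_mono _ (Set.subset_univ _)).trans_eq
      ((PMF.toOuterMeasure_apply_eq_one_iff _ _).2 (Set.subset_univ _))).trans_lt
        ENNReal.one_lt_top).ne
  rw [ENNReal.lt_ofReal_iff_toReal_lt hfin]
  rcases h with h | ⟨h1, h2, h3⟩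
  · exact (failure_of_no_noise hd hwin h).trans_lt hδ
  · exact (failure_lt hd hV hn hwin ha hb hη hu hz hcl hcut hD hη1 hη2 hη3 hη4 hη5 hz1 hz2 h1 h2
      h3).trans_le hδm

/-- All bounds follow by making `256 η` smaller than finitely many positive constants. The bound `η
< 1` serves the case `α ≤ 0`. -/
theorem exists_noise_constant {a b ε : ℝ} (ha : 0 < a) (hb : 0 < b) (hε : 0 < ε) :
    ∃ η : ℝ, 0 < η ∧ 4 * η ≤ a ^ 2 * b ∧ 64 * η ≤ a ^ 4 * b ∧ 256 * η ≤ a ^ 2 * b ∧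
      4 * η ≤ a ^ 2 ∧ 4 * η / a ^ 2 * (32 / b) ≤ ε / 2 ∧ η < 1 := by
  have h1 : Tendsto (fun η : ℝ => 256 * η) (nhdsWithin 0 (Set.Ioi 0)) (nhds 0) :=
    tendsto_nhdsWithin_of_tendsto_nhds
      ((by fun_prop : Continuous fun η : ℝ => 256 * η).tendsto' 0 0 (by simp))
  have key : ∀ c : ℝ, 0 < c → ∀ᶠ η : ℝ in nhdsWithin 0 (Set.Ioi 0), 256 * η < c :=
    fun c hc => h1.eventually_lt_const hc
  obtain ⟨η, hη, e1, e2, e3, e4, e5⟩ := (eventually_mem_nhdsWithin.and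
    ((key (a ^ 2 * b) (by positivity)).and ((key (a ^ 4 * b) (by positivity)).and
    ((key (a ^ 2) (by positivity)).and ((key (a ^ 2 * b * ε) (by positivity)).and
      (key 1 one_pos)))))).exists
  have hη0 : 0 < η := hη
  refine ⟨η, hη0, by linarith, by linarith, by linarith, by linarith, ?_, by linarith⟩
  rw [div_mul_div_comm, div_le_div_iff₀ (by positivity) two_pos]
  linarith

end AdaptiveClustering

theorem mainTheorem9
    (α β : ℝ) (hβα : β < α)
    -- constants in the lower bounds on the cluster sizes and on the inner minimal cut
    (a b : ℝ) (ha : 0 < a) (hb : 0 < b)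
    -- bound on the number of unit edges between two clusters
    (cout : ℕ → ℝ) (hcout : cout =o[atTop] fun n : ℕ => (n : ℝ) ^ α)
    -- constant and logarithmic factor in the lower bound on the number of samples
    (C q : ℝ) (hC : 0 < C) :
    ∃ n₀ : ℕ, ∀ n : ℕ, n₀ ≤ n →
      ∀ (k : ℕ) (cl : Fin n → Fin k) (win : Sym2 (Fin n) → ℝ) (d : Sym2 (Fin k) → ℕ)
        (hd : (AdaptiveClustering.noiseSets cl d).Nonempty)
        (A : AdaptiveClustering.AdaptiveScheme (Fin n)) (m : ℕ) (δ : ℝ),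
        (∀ i : Fin k, a * n ≤ ((AdaptiveClustering.cluster cl i).card : ℝ)) →
        (∀ e, win e ∈ Set.Icc (0 : ℝ) 1) →
        ((b * (n : ℝ) ^ α : ℝ) : EReal) ≤ AdaptiveClustering.minInnerCut win cl →
        (∀ i j : Fin k, i ≠ j → (d s(i, j) : ℝ) ≤ cout n) →
        0 < δ → δ < 1 →
        C * (n : ℝ) ^ (2 - β) * Real.log n ^ q * k * Real.log (1 / δ) ≤ m →
        (AdaptiveClustering.sampledGraphLaw cl win d hd A m).toOuterMeasure
            {w | AdaptiveClustering.minInnerCut w cl < AdaptiveClustering.maxOuterCut w cl}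
          < ENNReal.ofReal δ := by
  -- Of the surplus n^(2ε), one factor n^ε absorbs `C (ln n)^q` and the other becomes `z`.
  obtain ⟨ε, hε, hαβ⟩ : ∃ ε : ℝ, 0 < ε ∧ α - β = 2 * ε := ⟨(α - β) / 2, by linarith, by ring⟩
  obtain ⟨η, hη, hη1, hη2, hη3, hη4, hη5, hη6⟩ :=
    AdaptiveClustering.exists_noise_constant ha hb hε
  have hlog_lt : ∀ r c : ℝ, 0 < c → ∀ᶠ n : ℕ in atTop, 0 < r →
      32 / b * Real.log n ≤ c * (n : ℝ) ^ r := by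
    intro r c hc
    by_cases hr : 0 < r
    · filter_upwards [AdaptiveClustering.eventually_mul_log_le_rpow (32 / b) hc hr] with n h _
      exact h
    · exact Eventually.of_forall fun n h => absurd h hr
  obtain ⟨n₀, hn₀⟩ := eventually_atTop.1 ((hcout.def hη).and
    ((AdaptiveClustering.eventually_one_le_mul_log_rpow q hC hε).and
    ((((tendsto_rpow_atTop hε).comp tendsto_natCast_atTop_atTop).eventually_ge_atTop
      (128 / b)).and ((hlog_lt (ε / 2) (1 / 2) (by norm_num)).and
    ((hlog_lt α (a ^ 2 / 2) (by positivity)).and ((hlog_lt (α - 2) (1 / 2) (by norm_num)).and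
      (eventually_ge_atTop 82)))))))
  refine ⟨n₀, fun n hn k cl win d hd A m δ hcl hwin hcut hd' hδ0 hδ1 hm => ?_⟩
  obtain ⟨e1, e2, e3, e4, e5, e6, e7⟩ := hn₀ n hn
  have hn0 : (0 : ℝ) < n := by exact_mod_cast (by omega : 0 < n)
  have hn1 : (1 : ℝ) ≤ n := by exact_mod_cast (by omega : 1 ≤ n)
  have hpos : ∀ r : ℝ, 0 < (n : ℝ) ^ r := Real.rpow_pos_of_pos hn0
  have hu : (n : ℝ) ^ (α - 2) * (n : ℝ) ^ 2 = (n : ℝ) ^ α := by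
    rw [← Real.rpow_natCast, ← Real.rpow_add hn0]
    congr 1
    push_cast
    ring
  have hD : ∀ i j : Fin k, i ≠ j → (d s(i, j) : ℝ) ≤ η * (n : ℝ) ^ α := by
    intro i j hij
    refine (hd' i j hij).trans ((Real.le_norm_self _).trans (e1.trans_eq ?_))
    rw [Real.norm_of_nonneg (hpos α).le]
  have hk : 1 ≤ k := by
    have := (cl ⟨0, by omega⟩).pos
    omega
  have hk' : (1 : ℝ) ≤ k := by exact_mod_cast hk
  have hlogδ : 0 < Real.log (1 / δ) := Real.log_pos (by rw [lt_div_iff₀ hδ0]; linarith)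
  have hscale : (n : ℝ) ^ ε ≤ C * (n : ℝ) ^ (2 - β) * Real.log n ^ q * k * (n : ℝ) ^ (α - 2) := by
    have h1 : (n : ℝ) ^ (2 - β) * (n : ℝ) ^ (α - 2) = (n : ℝ) ^ ε * (n : ℝ) ^ ε := by
      rw [← Real.rpow_add hn0, ← Real.rpow_add hn0]
      congr 1
      linarith
    calc (n : ℝ) ^ ε ≤ (n : ℝ) ^ ε * (C * (n : ℝ) ^ ε * Real.log n ^ q) * k := by
          have h2 := mul_le_mul e2 hk' zero_le_one (zero_le_one.trans e2)
          have h3 := mul_le_mul_of_nonneg_left h2 (hpos ε).le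
          linarith
      _ = C * ((n : ℝ) ^ ε * (n : ℝ) ^ ε) * Real.log n ^ q * k := by ring
      _ = _ := by rw [← h1]; ring
  have hmδ : Real.log (1 / δ) * (n : ℝ) ^ ε ≤ m * (n : ℝ) ^ (α - 2) := by
    have h1 := mul_le_mul_of_nonneg_left hscale hlogδ.le
    have h2 := mul_le_mul_of_nonneg_right hm (hpos (α - 2)).le
    linarith
  have hm0 : 0 < m := by
    have h1 : 0 < (m : ℝ) * (n : ℝ) ^ (α - 2) := (mul_pos hlogδ (hpos ε)).trans_le hmδ
    exact_mod_cast pos_of_mul_pos_left h1 (hpos _).le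
  refine AdaptiveClustering.failure_measure_lt (u := (n : ℝ) ^ (α - 2)) (z := (n : ℝ) ^ ε)
    hd (Fintype.card_fin n) e7 hwin ha hb hη.le (hpos _) (hpos _) hcl (by rwa [hu])
    (by rwa [hu]) hη1 hη2 hη3 hη4 hη5 e3 ?_ ?_ hδ0 ?_
  · have h1 : Real.exp (-(ε / 2 * Real.log n)) = ((n : ℝ) ^ (ε / 2))⁻¹ := by
      rw [Real.exp_neg, Real.rpow_def_of_pos hn0, mul_comm]
    have h2 : (n : ℝ) ^ ε = (n : ℝ) ^ (ε / 2) * (n : ℝ) ^ (ε / 2) := by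
      rw [← Real.rpow_add hn0]
      congr 1
      ring
    rw [h1, h2, div_lt_iff₀ (mul_pos (hpos _) (hpos _)), inv_mul_cancel_left₀ (hpos _).ne']
    linarith [e4 (by linarith), hpos (ε / 2)]
  -- For `α ≤ 0` a pair of clusters has fewer than one noise edge, hence none, and failure is
  -- impossible.
  · rcases le_or_gt α 0 with hα | hα
    · left
      intro i j hij
      have h1 : (n : ℝ) ^ α ≤ 1 := Real.rpow_le_one_of_one_le_of_nonpos hn1 hα
      have h2 : (d s(i, j) : ℝ) < 1 := by
        have := mul_le_mul_of_nonneg_left h1 hη.le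
        linarith [hD i j hij]
      have h3 : d s(i, j) < 1 := by exact_mod_cast h2
      omega
    · refine Or.inr ⟨?_, ?_, hm0⟩
      · rw [div_le_iff₀ (hpos _)]
        refine (e5 hα).trans (le_of_eq ?_)
        rw [← hu]
        ring
      · rcases le_or_gt α 2 with hα2 | hα2
        · exact Or.inr (Real.rpow_le_one_of_one_le_of_nonpos hn1 (by linarith))
        -- For `α > 2` the few-sample regime ends below one sample, so it is empty.
        · left
          rw [div_lt_one (hpos _)]
          linarith [e6 (by linarith), hpos (α - 2)]
  · rw [← Real.le_log_iff_exp_le hδ0]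
    rw [one_div, Real.log_inv] at hmδ
    have h1 : -Real.log δ ≤ m * (n : ℝ) ^ (α - 2) / (n : ℝ) ^ ε := (le_div_iff₀ (hpos _)).2 hmδ
    linarith
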